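/- Let $N\ge 2$, let $\ell_1,\dots,\ell_N\in(0,\infty]$ and $\omega_1,\dots,\omega_N\in\mathbb R$, and let $\mathcal H=\bigoplus_{j=1}^N L^2(0,\ell_j)$ be the state space of the star graph whose links $(0,\ell_j)$ are joined at the vertex $x=0$. For real-valued potentials $U=(U_1,\dots,U_N)$ which are integrable on all bounded subintervals of the links (up to the endpoint $0$, and up to $\ell_j$ if $\ell_j<\infty$), and for $\alpha\in\mathbb R$, let $H_\alpha(U)$ be the operator $\{\psi_j\}\mapsto\{-\psi_j''+U_j\psi_j\}$ in $\mathcal H$ whose domain consists of all $\{\psi_j\}\in\mathcal H$ such that $\psi_j,\psi_j'$ are locally absolutely continuous on the link including its finite endpoints, $\{-\psi_j''+U_j\psi_j\}\in\mathcal H$, $$\psi_1(0+)=\dots=\psi_N(0+)=:\psi(0),\qquad \sum_{j=1}^N\psi_j'(0+)=\alpha\,\psi(0),$$ and $\psi_j(\ell_j)\cos\omega_j+\psi_j'(\ell_j)\sin\omega_j=0$ for every $j$ with $\ell_j<\infty$. Theorem. Let $V_1,\dots,V_N$ be real-valued potentials on the links which are integrable on all bounded subintervals as above and (essentially) bounded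 below, and let $W_j\in L^1(0,\ell_j)$ be real-valued, $j=1,\dots,N$. Put $W_{\varepsilon,j}(x)=\varepsilon^{-1}W_j(x/\varepsilon)$ for $\varepsilon>0$, where $W_j$ is extended by $0$ outside $(0,\ell_j)$, and $$\alpha=\sum_{j=1}^N\int_0^{\ell_j}W_j(x)\,dx .$$ Then $H_0(V+W_\varepsilon)\to H_\alpha(V)$ in the norm resolvent sense as $\varepsilon\to0+$; that is, $H_\alpha(V)$ is self-adjoint, $H_0(V+W_\varepsilon)$ is self-adjoint for all sufficiently small $\varepsilon>0$, and for every $z\in\mathbb C\setminus\mathbb R$ $$\bigl\|(H_0(V+W_\varepsilon)-z)^{-1}-(H_\alpha(V)-z)^{-1}\bigr\|\to0\qquad(\varepsilon\to0+).$$ -/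

import Mathlib

open MeasureTheory Set Filter Topology

namespace StarGraph

noncomputable section

/-- The open link `(0, ℓ)`, where `ℓ` may be `∞` (written `⊤`). -/
def link (ℓ : EReal) : Set ℝ := {x | 0 < x ∧ (x : EReal) < ℓ}

/-- The link with its (finite) endpoints: `[0, ℓ]` if `ℓ < ∞`, and `[0, ∞)` if `ℓ = ∞`. -/
def closedLink (ℓ : EReal) : Set ℝ := {x | 0 ≤ x ∧ (x : EReal) ≤ ℓ}

/-- Lebesgue measure on the link `(0, ℓ)`. -/
abbrev linkMeasure (ℓ : EReal) : Measure ℝ := volume.restrict (link ℓ)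

/-- The state space `⨁ⱼ L²(0, ℓⱼ)` (complex-valued functions, Hilbert space direct sum). -/
abbrev StateSpace {N : ℕ} (ℓ : Fin N → EReal) : Type :=
  PiLp 2 (fun j : Fin N => Lp ℂ 2 (linkMeasure (ℓ j)))

/-- `F` is locally absolutely continuous on the link with its endpoints, and `p` is its derivative
(defined almost everywhere, and integrable on bounded subintervals). -/
def HasLocACDeriv (ℓ : EReal) (F p : ℝ → ℂ) : Prop :=
  ∀ x ∈ closedLink ℓ, IntervalIntegrable p volume 0 x ∧ F x = F 0 + ∫ t in (0 : ℝ)..x, p t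

theorem HasLocACDeriv.zero (ℓ : EReal) : HasLocACDeriv ℓ 0 0 := by
  intro x _
  exact ⟨(intervalIntegrable_const : IntervalIntegrable (fun _ => (0 : ℂ)) volume 0 x), by simp⟩

theorem HasLocACDeriv.add {ℓ : EReal} {F p G q : ℝ → ℂ} (hF : HasLocACDeriv ℓ F p)
    (hG : HasLocACDeriv ℓ G q) : HasLocACDeriv ℓ (F + G) (p + q) := by
  intro x hx
  obtain ⟨h1, h2⟩ := hF x hx
  obtain ⟨h3, h4⟩ := hG x hx
  refine ⟨h1.add h3, ?_⟩
  simp only [Pi.add_apply]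
  rw [intervalIntegral.integral_add h1 h3, h2, h4]
  ring

theorem HasLocACDeriv.smul {ℓ : EReal} {F p : ℝ → ℂ} (c : ℂ) (hF : HasLocACDeriv ℓ F p) :
    HasLocACDeriv ℓ (c • F) (c • p) := by
  intro x hx
  obtain ⟨h1, h2⟩ := hF x hx
  refine ⟨h1.smul c, ?_⟩
  simp only [Pi.smul_apply]
  rw [intervalIntegral.integral_smul, h2, smul_add]

theorem HasLocACDeriv.ae_deriv_eq_zero {ℓ : EReal} {F p : ℝ → ℂ} (hF : HasLocACDeriv ℓ F p)
    (h0 : F =ᵐ[linkMeasure ℓ] 0) : p =ᵐ[linkMeasure ℓ] 0 := by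
  have key : ∀ b ∈ link ℓ, ∀ᵐ x, x ∈ Ioo 0 b → p x = 0 := by
    intro b hb
    have hsub : Icc 0 b ⊆ closedLink ℓ := fun x hx =>
      ⟨hx.1, (EReal.coe_le_coe_iff.2 hx.2).trans hb.2.le⟩
    have hsub' : Ioo 0 b ⊆ link ℓ := fun x hx =>
      ⟨hx.1, (EReal.coe_lt_coe_iff.2 hx.2).trans hb.2⟩
    have hp : IntervalIntegrable p volume 0 b := (hF b (hsub ⟨hb.1.le, le_rfl⟩)).1
    have hcont : ContinuousOn F (Icc 0 b) := by
      have h1 : ContinuousOn (fun x => F 0 + ∫ t in (0 : ℝ)..x, p t) (Icc 0 b) := by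
        have := intervalIntegral.continuousOn_primitive_interval' hp left_mem_uIcc
        rw [uIcc_of_le hb.1.le] at this
        exact continuousOn_const.add this
      exact h1.congr fun x hx => (hF x (hsub hx)).2
    have hz : EqOn F 0 (Ioo 0 b) := by
      refine Measure.eqOn_open_of_ae_eq (μ := volume) ?_ isOpen_Ioo
        (hcont.mono Ioo_subset_Icc_self) continuousOn_const
      exact ae_restrict_of_ae_restrict_of_subset hsub' h0
    filter_upwards [hp.ae_hasDerivAt_integral] with x hx hxb
    have hx' := hx (by rw [uIcc_of_le hb.1.le]; exact Ioo_subset_Icc_self hxb) 0 left_mem_uIcc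
    have hconst : (fun u => ∫ t in (0 : ℝ)..u, p t) =ᶠ[𝓝 x] fun _ => - F 0 := by
      filter_upwards [isOpen_Ioo.mem_nhds hxb] with u hu
      have h1 := (hF u (hsub (Ioo_subset_Icc_self hu))).2
      rw [hz hu] at h1
      exact (neg_eq_of_add_eq_zero_right h1.symm).symm
    exact (hx'.congr_of_eventuallyEq hconst.symm).unique (hasDerivAt_const x (- F 0))
  have hall : ∀ᵐ x, ∀ q : ℚ, (q : ℝ) ∈ link ℓ → x ∈ Ioo 0 (q : ℝ) → p x = 0 := by
    rw [ae_all_iff]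
    intro q
    by_cases hq : (q : ℝ) ∈ link ℓ
    · filter_upwards [key q hq] with x hx _ using hx
    · exact Eventually.of_forall fun x h => absurd h hq
  refine (ae_restrict_of_ae hall).mp ?_
  have hmeas : MeasurableSet (link ℓ) :=
    (isOpen_lt continuous_const continuous_id).measurableSet.inter
      (isOpen_lt continuous_coe_real_ereal continuous_const).measurableSet
  filter_upwards [ae_restrict_mem hmeas] with x hx hq
  obtain ⟨q, hq1, hq2⟩ := EReal.lt_iff_exists_rat_btwn.1 hx.2
  have hq1' : x < (q : ℝ) := by exact_mod_cast hq1
  exact hq q ⟨hx.1.trans hq1', hq2⟩ ⟨hx.1, hq1'⟩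

/-- The graph of the Schrödinger operator `H_α(V)` with `δ` coupling `α` at the vertex: the pairs
`(ψ, φ)` of states such that `ψⱼ, ψⱼ'` are locally absolutely continuous on each link (up to its
endpoints), `φⱼ = -ψⱼ'' + Vⱼ ψⱼ`,

* at the vertex, `ψ₁(0) = ⋯ = ψ_N(0) =: c` and `∑ⱼ ψⱼ'(0) = α c`;
* at the end of each link of finite length `b = ℓⱼ`,
  `ψⱼ(b) cos ωⱼ + ψⱼ'(b) sin ωⱼ = 0`.

Here `f j`, `f' j`, `f'' j` are (representatives of) `ψⱼ`, `ψⱼ'`, `ψⱼ''`. The requirements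
`ψ ∈ ⨁ L²` and `{-ψⱼ'' + Vⱼ ψⱼ} ∈ ⨁ L²` are contained in the types of `ψ` and `φ`. -/
def hamiltonianGraph {N : ℕ} (ℓ : Fin N → EReal) (ω : Fin N → ℝ) (α : ℝ) (V : Fin N → ℝ → ℝ) :
    Submodule ℂ (StateSpace ℓ × StateSpace ℓ) where
  carrier := {P | ∃ f f' f'' : Fin N → ℝ → ℂ,
    (∀ j, P.1 j =ᵐ[linkMeasure (ℓ j)] f j) ∧
    (∀ j, HasLocACDeriv (ℓ j) (f j) (f' j)) ∧
    (∀ j, HasLocACDeriv (ℓ j) (f' j) (f'' j)) ∧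
    (∀ j, P.2 j =ᵐ[linkMeasure (ℓ j)] fun x => - f'' j x + (V j x : ℂ) * f j x) ∧
    (∃ c : ℂ, (∀ j, f j 0 = c) ∧ ∑ j, f' j 0 = (α : ℂ) * c) ∧
    (∀ j, ∀ b : ℝ, ℓ j = (b : EReal) →
      f j b * (Real.cos (ω j) : ℂ) + f' j b * (Real.sin (ω j) : ℂ) = 0)}
  zero_mem' := by
    refine ⟨0, 0, 0, fun j => ?_, fun j => HasLocACDeriv.zero _, fun j => HasLocACDeriv.zero _,
      fun j => ?_, ⟨0, fun j => rfl, by simp⟩, fun j b _ => by simp⟩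
    · exact Lp.coeFn_zero _ _ _
    · filter_upwards [Lp.coeFn_zero ℂ 2 (linkMeasure (ℓ j))] with x hx
      simpa using hx
  add_mem' := by
    rintro P Q ⟨f, f', f'', h1, h2, h3, h4, ⟨c, h5, h6⟩, h7⟩
      ⟨g, g', g'', k1, k2, k3, k4, ⟨d, k5, k6⟩, k7⟩
    refine ⟨f + g, f' + g', f'' + g'', fun j => ?_, fun j => (h2 j).add (k2 j),
      fun j => (h3 j).add (k3 j), fun j => ?_, ⟨c + d, fun j => ?_, ?_⟩, fun j b hb => ?_⟩
    · filter_upwards [h1 j, k1 j, Lp.coeFn_add (P.1 j) (Q.1 j)] with x a1 a2 a3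
      rw [Prod.fst_add, PiLp.add_apply, a3]
      simp [a1, a2]
    · filter_upwards [h4 j, k4 j, Lp.coeFn_add (P.2 j) (Q.2 j)] with x a1 a2 a3
      rw [Prod.snd_add, PiLp.add_apply, a3]
      simp only [Pi.add_apply, a1, a2]
      ring
    · simp [h5, k5]
    · simp [Finset.sum_add_distrib, h6, k6, mul_add]
    · have e1 := h7 j b hb
      have e2 := k7 j b hb
      simp only [Pi.add_apply]
      linear_combination e1 + e2
  smul_mem' := by
    rintro a P ⟨f, f', f'', h1, h2, h3, h4, ⟨c, h5, h6⟩, h7⟩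
    refine ⟨a • f, a • f', a • f'', fun j => ?_, fun j => (h2 j).smul a,
      fun j => (h3 j).smul a, fun j => ?_, ⟨a * c, fun j => ?_, ?_⟩, fun j b hb => ?_⟩
    · filter_upwards [h1 j, Lp.coeFn_smul a (P.1 j)] with x a1 a3
      rw [Prod.smul_fst, PiLp.smul_apply, a3]
      simp [a1]
    · filter_upwards [h4 j, Lp.coeFn_smul a (P.2 j)] with x a1 a3
      rw [Prod.smul_snd, PiLp.smul_apply, a3]
      simp only [Pi.smul_apply, a1, smul_eq_mul]
      ring
    · simp [h5]
    · simp only [Pi.smul_apply, smul_eq_mul, ← Finset.mul_sum, h6]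
      ring
    · have e1 := h7 j b hb
      simp only [Pi.smul_apply, smul_eq_mul]
      linear_combination a * e1

theorem hamiltonianGraph_snd_eq_zero {N : ℕ} (ℓ : Fin N → EReal) (ω : Fin N → ℝ) (α : ℝ)
    (V : Fin N → ℝ → ℝ) (P : StateSpace ℓ × StateSpace ℓ) (hP : P ∈ hamiltonianGraph ℓ ω α V)
    (h0 : P.1 = 0) : P.2 = 0 := by
  obtain ⟨f, f', f'', h1, h2, h3, h4, -, -⟩ := hP
  ext j : 1
  refine Lp.ext ?_
  have e0 : f j =ᵐ[linkMeasure (ℓ j)] 0 := by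
    filter_upwards [h1 j, Lp.coeFn_zero ℂ 2 (linkMeasure (ℓ j))] with x a1 a2
    rw [← a1, h0]
    exact a2
  have e1 := (h2 j).ae_deriv_eq_zero e0
  have e2 := (h3 j).ae_deriv_eq_zero e1
  filter_upwards [h4 j, e0, e2, Lp.coeFn_zero ℂ 2 (linkMeasure (ℓ j))] with x a1 a2 a3 a4
  rw [a1, a2, a3]
  simpa using a4.symm

/-- The Schrödinger operator `H_α(V) {ψⱼ} = {-ψⱼ'' + Vⱼ ψⱼ}` on the star graph with links of lengths
`ℓⱼ`, with `δ` coupling `α` at the vertex and the boundary conditions given by `ωⱼ` at the ends of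
the finite links, as an unbounded operator. Its graph is `hamiltonianGraph`, see
`graph_hamiltonian`. -/
def hamiltonian {N : ℕ} (ℓ : Fin N → EReal) (ω : Fin N → ℝ) (α : ℝ) (V : Fin N → ℝ → ℝ) :
    StateSpace ℓ →ₗ.[ℂ] StateSpace ℓ :=
  (hamiltonianGraph ℓ ω α V).toLinearPMap

theorem graph_hamiltonian {N : ℕ} (ℓ : Fin N → EReal) (ω : Fin N → ℝ) (α : ℝ)
    (V : Fin N → ℝ → ℝ) : (hamiltonian ℓ ω α V).graph = hamiltonianGraph ℓ ω α V :=
  Submodule.toLinearPMap_graph_eq _ (hamiltonianGraph_snd_eq_zero ℓ ω α V)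

/-- The squeezed potential `W_ε(x) = ε⁻¹ W(x/ε)`, where a potential `W` on `(0, ℓ)` is understood
to vanish outside `(0, ℓ)`. -/
def squeezed (ℓ : EReal) (ε : ℝ) (W : ℝ → ℝ) : ℝ → ℝ :=
  fun x => ε⁻¹ * (link ℓ).indicator W (x / ε)

section Resolvent

variable {E : Type*} [NormedAddCommGroup E] [InnerProductSpace ℂ E] [CompleteSpace E]

/-- The bounded everywhere defined operator `R` is the resolvent `(A - z)⁻¹`. -/
def IsResolventAt (A : E →ₗ.[ℂ] E) (z : ℂ) (R : E →L[ℂ] E) : Prop :=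
  (∀ y : E, ∃ x : A.domain, (x : E) = R y ∧ A x - z • (x : E) = y) ∧
    ∀ x : A.domain, R (A x - z • (x : E)) = x

/-- Norm resolvent convergence, along a filter `l`, of self-adjoint operators `A i` to a self-adjoint
operator `B`: for every non-real `z`, the resolvents `(A i - z)⁻¹` converge to `(B - z)⁻¹` in the
operator norm. -/
def NormResolventTendsto {ι : Type*} (A : ι → E →ₗ.[ℂ] E) (l : Filter ι) (B : E →ₗ.[ℂ] E) :
    Prop :=
  (∀ᶠ i in l, IsSelfAdjoint (A i)) ∧ IsSelfAdjoint B ∧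
    ∀ z : ℂ, z.im ≠ 0 → ∃ (R : ι → E →L[ℂ] E) (S : E →L[ℂ] E),
      (∀ᶠ i in l, IsResolventAt (A i) z (R i)) ∧ IsResolventAt B z S ∧
        Tendsto (fun i => ‖R i - S‖) l (𝓝 0)

end Resolvent

end

end StarGraph

/-! The proof compares quadratic forms on one fixed form domain. Let `m` be a common lower bound of
the `V j`. Shifted by `s² - m`, the energies of the limit operator and of all approximating ones
live on the same Hilbert space `Q`: functions `ψ` continuous at the vertex, with `ψ'`, `√(V-m) ψ`
and `ψ` in `L²` and the Dirichlet end conditions built in, normed by `|ψ(0)|² + ∑ⱼ ∫ (|ψⱼ'|² +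
(Vⱼ-m+s²)|ψⱼ|²)`. The rest of the energy, namely the coupling, the potentials `W_ε` and the Robin
end terms, is controlled by point evaluations. For `s = 1/L` these satisfy `|ψ(x)|² ≤ 2L‖ψ‖²`
(`sq_norm_evalAt_le`), so the rest is represented by a self-adjoint operator `T` on `Q` with `‖T‖ ≤
2LC`, where `C` depends on the potentials only through their scale-invariant `L¹` norms
(`exists_pertOperator`). For small `L` all these operators are contractions uniformly in `ε`, and
the resolvent at the real point `m - s²` is `J (1 + T)⁻¹ J*`, with `J : Q → ⨁ L²` the inclusion.

Convergence: after the substitution `x = εy`, the forms of `W_ε` and of the coupling `α` differ by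
at most `∑ⱼ ∫ |Wⱼ(y)| μ(εy) dy · ‖p‖‖q‖`, where `μ` is a bounded modulus of continuity at the vertex
(`norm_pertForm_sub_le`). Dominated convergence gives `T_ε → S` in norm, hence convergence of the
resolvents at `m - s²`, and the resolvent identity carries it to every non-real `z`
(`normResolventTendsto_of_tendsto`).

Identification of `J (1 + T)⁻¹ J*` with the resolvent of the concrete operator has two halves. Weak
solutions are strong ones, by a du Bois-Reymond argument and special test functions
(`mem_hamiltonianGraph_of_inner`). Conversely `H - (m - s²)` is injective
(`eq_zero_of_mem_hamiltonianGraph`); functions in the operator domain are not known to have finite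
energy, so they are cut off and the localization error is sent to zero. -/

namespace StarGraph

noncomputable section

/-! ### Resolvents, self-adjointness and forms in an abstract Hilbert space -/

section AbstractResolvent

variable {E : Type*} [NormedAddCommGroup E] [InnerProductSpace ℂ E]

open scoped InnerProductSpace

/-- The resolvent at `z` in terms of the resolvent at `w`. -/
theorem IsResolventAt.mul_inverse {A : E →ₗ.[ℂ] E} {w z : ℂ} {R : E →L[ℂ] E}
    (h : IsResolventAt A w R) (hu : IsUnit (1 - (z - w) • R)) :
    IsResolventAt A z (R * Ring.inverse (1 - (z - w) • R)) := by
  obtain ⟨h1, h2⟩ := h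
  constructor
  · intro y
    obtain ⟨x, hx, hxy⟩ := h1 (Ring.inverse (1 - (z - w) • R) y)
    refine ⟨x, hx, ?_⟩
    have e : (1 - (z - w) • R) (Ring.inverse (1 - (z - w) • R) y) = y := by
      rw [← mul_apply_eq_comp, Ring.mul_inverse_cancel _ hu]
      rfl
    simp only [sub_apply, one_apply_eq_self, smul_apply] at e
    rw [← hx, ← hxy, sub_smul] at e
    rw [← e]
    abel
  · intro x
    have e : A x - z • (x : E) = (1 - (z - w) • R) (A x - w • (x : E)) := by
      simp only [sub_apply, one_apply_eq_self, smul_apply, h2 x, sub_smul]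
      abel
    rw [e, mul_apply_eq_comp, ← mul_apply_eq_comp (Ring.inverse _),
      Ring.inverse_mul_cancel _ hu]
    exact h2 x

variable [CompleteSpace E]

/-- An operator whose resolvent at some real point exists and is self-adjoint is self-adjoint. -/
theorem isSelfAdjoint_of_isResolventAt {A : E →ₗ.[ℂ] E} {t : ℝ} {R : E →L[ℂ] E}
    (hR : IsSelfAdjoint R) (h : IsResolventAt A t R) : IsSelfAdjoint A := by
  obtain ⟨h1, h2⟩ := h
  have hsym : ∀ x y : E, ⟪R x, y⟫_ℂ = ⟪x, R y⟫_ℂ := fun x y =>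
    (ContinuousLinearMap.isSelfAdjoint_iff_isSymmetric.1 hR) x y
  -- The domain is the range of `R`. If `y` is orthogonal to it, then `⟪R y, R y⟫ = ⟪y, R (R y)⟫ =
  -- 0`, and `R y = 0` forces `y = 0` because `(A - t) R y = y`.
  have hdense : Dense (A.domain : Set E) := by
    rw [Submodule.dense_iff_topologicalClosure_eq_top, Submodule.topologicalClosure_eq_top_iff,
      Submodule.eq_bot_iff]
    intro y hy
    obtain ⟨x, hx, hxy⟩ := h1 y
    have hR0 : R y = 0 := by
      rw [← inner_self_eq_zero (𝕜 := ℂ), hsym]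
      obtain ⟨x', hx', -⟩ := h1 (R y)
      rw [← hx', ← inner_conj_symm, (Submodule.mem_orthogonal _ _).1 hy x' x'.2, map_zero]
    have hx0 : x = 0 := by
      ext
      rw [hx, hR0]
      rfl
    rw [← hxy, hx0]
    simp
  have hformal : A.IsFormalAdjoint A := by
    intro x x'
    have e1 := h2 x
    have e2 := h2 x'
    have e3 : ⟪A x - (t : ℂ) • (x : E), (x' : E)⟫_ℂ = ⟪(x : E), A x' - (t : ℂ) • (x' : E)⟫_ℂ := by
      conv_lhs => rw [← e2]
      conv_rhs => rw [← e1]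
      exact (hsym _ _).symm
    rw [inner_sub_left, inner_sub_right, inner_smul_left, inner_smul_right, Complex.conj_ofReal,
      sub_left_inj] at e3
    exact e3
  have hle : A ≤ A.adjoint := hformal.le_adjoint hdense
  rw [LinearPMap.isSelfAdjoint_def]
  refine (LinearPMap.eq_of_le_of_domain_eq hle (le_antisymm hle.1 ?_)).symm
  intro w hw
  -- For `w` in the adjoint domain, `x = R (A* w - t w)` lies in the domain of `A`. The difference
  -- `w - x` is orthogonal to the range of `A - t`, which is everything.
  obtain ⟨x, hx, hxy⟩ := h1 (A.adjoint ⟨w, hw⟩ - (t : ℂ) • w)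
  have hwx : w = x := by
    rw [← sub_eq_zero, ← inner_self_eq_zero (𝕜 := ℂ)]
    obtain ⟨u, -, hu⟩ := h1 (w - x)
    have e1 : ⟪A.adjoint ⟨w, hw⟩, (u : E)⟫_ℂ = ⟪w, A u⟫_ℂ :=
      LinearPMap.adjoint_isFormalAdjoint hdense ⟨w, hw⟩ u
    have e2 : ⟪A x, (u : E)⟫_ℂ = ⟪(x : E), A u⟫_ℂ := hformal x u
    have e3 := congrArg (fun s => ⟪s, (u : E)⟫_ℂ) hxy
    simp only [inner_sub_left, inner_smul_left, Complex.conj_ofReal, e1, e2] at e3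
    nth_rewrite 2 [← hu]
    simp only [inner_sub_left, inner_sub_right, inner_smul_right]
    linear_combination -e3
  rw [hwx]
  exact x.2

/-- `1 - s R = s (s⁻¹ - R)`, and the non-real number `s⁻¹` is not in the spectrum of a self-adjoint
operator. -/
theorem isUnit_one_sub_smul_of_isSelfAdjoint {R : E →L[ℂ] E} (hR : IsSelfAdjoint R) {s : ℂ}
    (hs : s.im ≠ 0) : IsUnit (1 - s • R) := by
  have hs0 : s ≠ 0 := by
    rintro rfl
    exact hs rfl
  have h : s⁻¹ ∉ spectrum ℂ R := fun hmem => by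
    have := hR.im_eq_zero_of_mem_spectrum hmem
    rw [Complex.inv_im, div_eq_zero_iff, neg_eq_zero] at this
    rcases this with h | h
    · exact hs h
    · exact hs0 (Complex.normSq_eq_zero.1 h)
  rw [spectrum.notMem_iff] at h
  have h' : (1 - s • R : E →L[ℂ] E) = s • (algebraMap ℂ (E →L[ℂ] E) s⁻¹ - R) := by
    rw [smul_sub, Algebra.algebraMap_eq_smul_one, smul_smul, mul_inv_cancel₀ hs0, one_smul]
  rw [h']
  exact h.smul (Units.mk0 s hs0)

/-- Norm convergence of the resolvents at one real point implies norm resolvent convergence. -/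
theorem normResolventTendsto_of_tendsto {ι : Type*} {A : ι → E →ₗ.[ℂ] E} {l : Filter ι}
    {B : E →ₗ.[ℂ] E} {t : ℝ} {R : ι → E →L[ℂ] E} {S : E →L[ℂ] E}
    (hR : ∀ᶠ i in l, IsSelfAdjoint (R i)) (hRA : ∀ᶠ i in l, IsResolventAt (A i) t (R i))
    (hS : IsSelfAdjoint S) (hSB : IsResolventAt B t S) (hRS : Tendsto R l (𝓝 S)) :
    NormResolventTendsto A l B := by
  refine ⟨?_, isSelfAdjoint_of_isResolventAt hS hSB, fun z hz => ?_⟩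
  · filter_upwards [hR, hRA] with i h1 h2 using isSelfAdjoint_of_isResolventAt h1 h2
  have hz' : (z - (t : ℂ)).im ≠ 0 := by simpa using hz
  have hu := isUnit_one_sub_smul_of_isSelfAdjoint hS hz'
  refine ⟨fun i => R i * Ring.inverse (1 - (z - t) • R i),
    S * Ring.inverse (1 - (z - t) • S), ?_, hSB.mul_inverse hu, ?_⟩
  · filter_upwards [hR, hRA] with i h1 h2
    exact h2.mul_inverse (isUnit_one_sub_smul_of_isSelfAdjoint h1 hz')
  · rw [← tendsto_iff_norm_sub_tendsto_zero]
    refine hRS.mul ?_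
    obtain ⟨u, hu⟩ := hu
    have hc := NormedRing.inverse_continuousAt u
    rw [hu] at hc
    exact hc.tendsto.comp (tendsto_const_nhds.sub (hRS.const_smul (z - (t : ℂ))))

variable {Q : Type*} [NormedAddCommGroup Q] [InnerProductSpace ℂ Q] [CompleteSpace Q]

/-- The operator `J (1 + T)⁻¹ J*`. If `Q` is a form domain with inclusion `J`, it is the inverse of
the operator with the form `⟪(1 + T) p, q⟫`. -/
def formResolvent (J : Q →L[ℂ] E) (T : Q →L[ℂ] Q) : E →L[ℂ] E :=
  J ∘L Ring.inverse (1 + T) ∘L ContinuousLinearMap.adjoint J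

theorem isUnit_one_add_of_norm_lt_one {T : Q →L[ℂ] Q} (hT : ‖T‖ < 1) : IsUnit (1 + T) := by
  have := isUnit_one_sub_of_norm_lt_one (x := -T) (by rwa [norm_neg])
  rwa [sub_neg_eq_add] at this

theorem isSelfAdjoint_formResolvent (J : Q →L[ℂ] E) {T : Q →L[ℂ] Q} (hT : IsSelfAdjoint T) :
    IsSelfAdjoint (formResolvent J T) := by
  have h : star (Ring.inverse (1 + T)) = Ring.inverse (1 + T) := by
    rw [← Ring.inverse_star, star_add, star_one, hT.star_eq]
  rw [ContinuousLinearMap.isSelfAdjoint_iff', formResolvent, ContinuousLinearMap.adjoint_comp,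
    ContinuousLinearMap.adjoint_comp, ContinuousLinearMap.adjoint_adjoint,
    ← ContinuousLinearMap.star_eq_adjoint (Ring.inverse (1 + T)), h]
  rfl

/-- Inversion is continuous at the unit `1 + S`, and `J` is the same for all `i`. This is where a
form domain independent of `ε` pays off. -/
theorem tendsto_formResolvent (J : Q →L[ℂ] E) {ι : Type*} {l : Filter ι} {T : ι → Q →L[ℂ] Q}
    {S : Q →L[ℂ] Q} (hS : ‖S‖ < 1) (h : Tendsto T l (𝓝 S)) :
    Tendsto (fun i => formResolvent J (T i)) l (𝓝 (formResolvent J S)) := by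
  obtain ⟨u, hu⟩ := isUnit_one_add_of_norm_lt_one hS
  have hc := NormedRing.inverse_continuousAt u
  rw [hu] at hc
  have h1 : Tendsto (fun i => Ring.inverse (1 + T i)) l (𝓝 (Ring.inverse (1 + S))) :=
    hc.tendsto.comp (tendsto_const_nhds.add h)
  exact ((ContinuousLinearMap.compL ℂ E Q E J).continuous.tendsto _).comp
    ((((ContinuousLinearMap.compL ℂ E Q Q).flip
      (ContinuousLinearMap.adjoint J)).continuous.tendsto _).comp h1)

/-- The element `p = (1 + T)⁻¹ J* g` of the form domain solves the weak equation. -/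
theorem exists_weak_solution (J : Q →L[ℂ] E) {T : Q →L[ℂ] Q} (hT : ‖T‖ < 1) (g : E) :
    ∃ p : Q, J p = formResolvent J T g ∧ ∀ q, ⟪p, q⟫_ℂ + ⟪T p, q⟫_ℂ = ⟪g, J q⟫_ℂ := by
  refine ⟨Ring.inverse (1 + T) (ContinuousLinearMap.adjoint J g), rfl, fun q => ?_⟩
  rw [← ContinuousLinearMap.adjoint_inner_left, ← inner_add_left]
  congr 1
  have := Ring.mul_inverse_cancel _ (isUnit_one_add_of_norm_lt_one hT)
  exact congrArg (fun X : Q →L[ℂ] Q => X (ContinuousLinearMap.adjoint J g)) this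

end AbstractResolvent

/-! ### Measure and integrals on a link -/

section Link

variable {ℓ : EReal}

theorem measurableSet_link (ℓ : EReal) : MeasurableSet (link ℓ) :=
  (isOpen_lt continuous_const continuous_id).measurableSet.inter
    (isOpen_lt continuous_coe_real_ereal continuous_const).measurableSet

theorem link_subset_closedLink : link ℓ ⊆ closedLink ℓ := fun _ hx => ⟨hx.1.le, hx.2.le⟩

theorem Icc_subset_closedLink {x : ℝ} (hx : x ∈ closedLink ℓ) : Icc 0 x ⊆ closedLink ℓ :=
  fun _ ht => ⟨ht.1, (EReal.coe_le_coe_iff.2 ht.2).trans hx.2⟩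

theorem Ioo_subset_link {x : ℝ} (hx : x ∈ closedLink ℓ) : Ioo 0 x ⊆ link ℓ :=
  fun _ ht => ⟨ht.1, (EReal.coe_lt_coe_iff.2 ht.2).trans_le hx.2⟩

theorem zero_mem_closedLink (hℓ : 0 < ℓ) : (0 : ℝ) ∈ closedLink ℓ := ⟨le_rfl, hℓ.le⟩

/-- On a closed subinterval starting at the vertex, the measure on the link is Lebesgue measure. -/
theorem restrict_linkMeasure_Ioc {x : ℝ} (hx : x ∈ closedLink ℓ) :
    (linkMeasure ℓ).restrict (Ioc 0 x) = volume.restrict (Ioc 0 x) := by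
  rw [linkMeasure, Measure.restrict_restrict measurableSet_Ioc]
  refine Measure.restrict_congr_set ?_
  have h : Ioo 0 x ⊆ Ioc 0 x ∩ link ℓ := fun t ht => ⟨Ioo_subset_Ioc_self ht, Ioo_subset_link hx ht⟩
  refine (inter_subset_left.eventuallyLE).antisymm ?_
  exact (Ioo_ae_eq_Ioc (μ := volume)).symm.le.trans h.eventuallyLE

theorem intervalIntegral_eq_setIntegral_linkMeasure {x : ℝ} (hx : x ∈ closedLink ℓ) (h : ℝ → ℂ) :
    ∫ t in (0 : ℝ)..x, h t = ∫ t in Ioc 0 x, h t ∂linkMeasure ℓ := by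
  rw [intervalIntegral.integral_of_le hx.1, restrict_linkMeasure_Ioc hx]

theorem intervalIntegrable_iff_integrableOn_linkMeasure {E : Type*} [NormedAddCommGroup E] {x : ℝ}
    (hx : x ∈ closedLink ℓ) {h : ℝ → E} :
    IntervalIntegrable h volume 0 x ↔ IntegrableOn h (Ioc 0 x) (linkMeasure ℓ) := by
  rw [intervalIntegrable_iff_integrableOn_Ioc_of_le hx.1, IntegrableOn, IntegrableOn,
    restrict_linkMeasure_Ioc hx]

/-- The integral over the link of a function vanishing beyond `x`. -/
theorem integral_linkMeasure_eq {x : ℝ} (hx : x ∈ closedLink ℓ) {h : ℝ → ℂ}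
    (h0 : ∀ t ∈ link ℓ, x < t → h t = 0) :
    ∫ t, h t ∂linkMeasure ℓ = ∫ t in (0 : ℝ)..x, h t := by
  rw [intervalIntegral_eq_setIntegral_linkMeasure hx]
  refine (setIntegral_eq_integral_of_ae_compl_eq_zero ?_).symm
  filter_upwards [ae_restrict_mem (measurableSet_link ℓ)] with t ht hn
  exact h0 t ht (not_le.1 fun h => hn ⟨ht.1, h⟩)

theorem integrable_linkMeasure_of_intervalIntegrable {E : Type*} [NormedAddCommGroup E] {x : ℝ}
    (hx : x ∈ closedLink ℓ) {h : ℝ → E}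
    (hi : IntervalIntegrable h volume 0 x) (h0 : ∀ t ∈ link ℓ, x < t → h t = 0) :
    Integrable h (linkMeasure ℓ) := by
  rw [intervalIntegrable_iff_integrableOn_linkMeasure hx] at hi
  refine hi.integrable_of_ae_notMem_eq_zero ?_
  filter_upwards [ae_restrict_mem (measurableSet_link ℓ)] with t ht hn
  exact h0 t ht (not_le.1 fun h => hn ⟨ht.1, h⟩)

/-- The intervals `(0, q)` with rational `q` in the link exhaust it, so only countably many null
sets are involved. -/
theorem ae_linkMeasure_of_ae_Ioo {P : ℝ → Prop}
    (h : ∀ x ∈ closedLink ℓ, ∀ᵐ t, t ∈ Ioo 0 x → P t) : ∀ᵐ t ∂linkMeasure ℓ, P t := by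
  have hall : ∀ᵐ x, ∀ q : ℚ, (q : ℝ) ∈ link ℓ → x ∈ Ioo 0 (q : ℝ) → P x := by
    rw [ae_all_iff]
    intro q
    by_cases hq : (q : ℝ) ∈ link ℓ
    · filter_upwards [h q (link_subset_closedLink hq)] with x hx _ using hx
    · exact Eventually.of_forall fun x h => absurd h hq
  filter_upwards [ae_restrict_mem (measurableSet_link ℓ), ae_restrict_of_ae hall] with x hx hq
  obtain ⟨q, hq1, hq2⟩ := EReal.lt_iff_exists_rat_btwn.1 hx.2
  have hq1' : x < (q : ℝ) := by exact_mod_cast hq1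
  exact hq q ⟨hx.1.trans hq1', hq2⟩ ⟨hx.1, hq1'⟩

end Link

/-! ### Calculus of locally absolutely continuous functions -/

section LocAC

variable {ℓ : EReal} {F G p q : ℝ → ℂ}

theorem HasLocACDeriv.continuousOn_Icc (hF : HasLocACDeriv ℓ F p) {x : ℝ} (hx : x ∈ closedLink ℓ) :
    ContinuousOn F (Icc 0 x) := by
  have h1 : ContinuousOn (fun x => F 0 + ∫ t in (0 : ℝ)..x, p t) (Icc 0 x) := by
    have := intervalIntegral.continuousOn_primitive_interval' (hF x hx).1 left_mem_uIcc
    rw [uIcc_of_le hx.1] at this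
    exact continuousOn_const.add this
  exact h1.congr fun t ht => (hF t (Icc_subset_closedLink hx ht)).2

/-- Real and imaginary parts of the primitive are absolutely continuous, and multiplying a real
function by a fixed `c : ℂ` only scales its variation sums by `‖c‖`. -/
theorem absolutelyContinuousOnInterval_integral {h : ℝ → ℂ} {x : ℝ}
    (hi : IntervalIntegrable h volume 0 x) :
    AbsolutelyContinuousOnInterval (fun u => ∫ t in (0 : ℝ)..u, h t) 0 x := by
  have hre : IntervalIntegrable (fun t => (h t).re) volume 0 x :=
    ⟨hi.1.re, hi.2.re⟩
  have him : IntervalIntegrable (fun t => (h t).im) volume 0 x :=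
    ⟨hi.1.im, hi.2.im⟩
  have h1 := (hre.absolutelyContinuousOnInterval_intervalIntegral (c := 0) left_mem_uIcc)
  have h2 := (him.absolutelyContinuousOnInterval_intervalIntegral (c := 0) left_mem_uIcc)
  have toC : ∀ {k : ℝ → ℝ} (c : ℂ), AbsolutelyContinuousOnInterval k 0 x →
      AbsolutelyContinuousOnInterval (fun u => k u • c) 0 x := by
    intro k c hk
    refine squeeze_zero (fun t => Finset.sum_nonneg fun i hi => dist_nonneg) (fun t => ?_)
      (by simpa using Tendsto.mul_const ‖c‖ hk)
    rw [Finset.sum_mul]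
    refine Finset.sum_le_sum fun i _ => ?_
    rw [dist_eq_norm, ← sub_smul, norm_smul, dist_eq_norm]
  have h3 := (toC 1 h1).add (toC Complex.I h2)
  have heq : ∀ u ∈ uIcc 0 x, ∫ t in (0 : ℝ)..u, h t =
      ((fun u => (∫ t in (0 : ℝ)..u, (h t).re) • (1 : ℂ)) +
        fun u => (∫ t in (0 : ℝ)..u, (h t).im) • Complex.I) u := by
    intro u hu
    have hi' : IntervalIntegrable h volume 0 u := hi.mono_set (uIcc_subset_uIcc left_mem_uIcc hu)
    have hre' : IntervalIntegrable (fun t => (h t).re) volume 0 u := ⟨hi'.1.re, hi'.2.re⟩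
    have him' : IntervalIntegrable (fun t => (h t).im) volume 0 u := ⟨hi'.1.im, hi'.2.im⟩
    simp only [Pi.add_apply]
    rw [← intervalIntegral.integral_smul_const, ← intervalIntegral.integral_smul_const,
      ← intervalIntegral.integral_add]
    · refine intervalIntegral.integral_congr fun t _ => ?_
      simp [Complex.re_add_im]
    · exact ⟨hre'.1.smul_const _, hre'.2.smul_const _⟩
    · exact ⟨him'.1.smul_const _, him'.2.smul_const _⟩
  refine Tendsto.congr' ?_ h3
  filter_upwards [mem_inf_of_right (mem_principal_self _)] with E hE
  refine Finset.sum_congr rfl fun i hi => ?_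
  rw [heq _ (hE.1 i hi).1, heq _ (hE.1 i hi).2]

/-- The product rule for locally absolutely continuous functions. -/
theorem HasLocACDeriv.mul (hF : HasLocACDeriv ℓ F p) (hG : HasLocACDeriv ℓ G q) :
    HasLocACDeriv ℓ (fun x => F x * G x) (fun x => p x * G x + F x * q x) := by
  intro x hx
  have hcF := hF.continuousOn_Icc hx
  have hcG := hG.continuousOn_Icc hx
  rw [← uIcc_of_le hx.1] at hcF hcG
  have hp := (hF x hx).1
  have hq := (hG x hx).1
  have hi : IntervalIntegrable (fun x => p x * G x + F x * q x) volume 0 x :=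
    (hp.mul_continuousOn hcG).add (hq.continuousOn_mul hcF)
  refine ⟨hi, ?_⟩
  -- `F` and `G` are known only on the closed link; these primitives are defined on the whole line
  -- and agree with them on `[0, x]`.
  set A : ℝ → ℂ := fun u => F 0 + ∫ t in (0 : ℝ)..u, p t with hA
  set B : ℝ → ℂ := fun u => G 0 + ∫ t in (0 : ℝ)..u, q t with hB
  have hconst : ∀ c : ℂ, AbsolutelyContinuousOnInterval (fun _ : ℝ => c) 0 x := fun c => by
    simpa [AbsolutelyContinuousOnInterval] using tendsto_const_nhds
  have hAac : AbsolutelyContinuousOnInterval A 0 x :=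
    (hconst (F 0)).add (absolutelyContinuousOnInterval_integral hp)
  have hBac : AbsolutelyContinuousOnInterval B 0 x :=
    (hconst (G 0)).add (absolutelyContinuousOnInterval_integral hq)
  have hAF : ∀ u ∈ uIcc 0 x, F u = A u := fun u hu =>
    (hF u (Icc_subset_closedLink hx (by rwa [uIcc_of_le hx.1] at hu))).2
  have hBG : ∀ u ∈ uIcc 0 x, G u = B u := fun u hu =>
    (hG u (Icc_subset_closedLink hx (by rwa [uIcc_of_le hx.1] at hu))).2
  -- The difference of the two sides is absolutely continuous with derivative zero almost
  -- everywhere, hence constant on `[0, x]`.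
  have hDac : AbsolutelyContinuousOnInterval
      (A * B - fun u => ∫ t in (0 : ℝ)..u, (p t * G t + F t * q t)) 0 x :=
    (hAac.smul hBac).sub (absolutelyContinuousOnInterval_integral hi)
  obtain ⟨C, hC⟩ := hDac.const_of_ae_hasDerivAt_zero (by
    filter_upwards [hp.ae_hasDerivAt_integral, hq.ae_hasDerivAt_integral,
      hi.ae_hasDerivAt_integral] with u h1 h2 h3 hu
    have d1 : HasDerivAt A (p u) u := (h1 hu 0 left_mem_uIcc).const_add (F 0)
    have d2 : HasDerivAt B (q u) u := (h2 hu 0 left_mem_uIcc).const_add (G 0)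
    have d3 := h3 hu 0 left_mem_uIcc
    convert (d1.mul d2).sub d3 using 1
    rw [hAF u hu, hBG u hu]
    ring)
  have e1 := hC x right_mem_uIcc
  have e0 := hC 0 left_mem_uIcc
  simp only [Pi.sub_apply, Pi.mul_apply, intervalIntegral.integral_same,
    sub_zero] at e1 e0
  rw [← e0, ← hAF x right_mem_uIcc, ← hBG x right_mem_uIcc, ← hAF 0 left_mem_uIcc,
    ← hBG 0 left_mem_uIcc] at e1
  linear_combination e1

theorem HasLocACDeriv.conj (hF : HasLocACDeriv ℓ F p) :
    HasLocACDeriv ℓ (fun x => starRingEnd ℂ (F x)) (fun x => starRingEnd ℂ (p x)) := by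
  intro x hx
  obtain ⟨h1, h2⟩ := hF x hx
  have hc : IntervalIntegrable (fun x => starRingEnd ℂ (p x)) volume 0 x :=
    ⟨(Complex.conjLIE.toContinuousLinearEquiv.toContinuousLinearMap.integrable_comp h1.1),
      (Complex.conjLIE.toContinuousLinearEquiv.toContinuousLinearMap.integrable_comp h1.2)⟩
  refine ⟨hc, ?_⟩
  simp only
  rw [h2, map_add, intervalIntegral.integral_of_le hx.1, intervalIntegral.integral_of_le hx.1,
    integral_conj]

theorem HasLocACDeriv.congr_ae (hF : HasLocACDeriv ℓ F p) (h : p =ᵐ[linkMeasure ℓ] q) :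
    HasLocACDeriv ℓ F q := by
  intro x hx
  obtain ⟨h1, h2⟩ := hF x hx
  rw [intervalIntegrable_iff_integrableOn_linkMeasure hx] at h1 ⊢
  rw [intervalIntegral_eq_setIntegral_linkMeasure hx] at h2 ⊢
  refine ⟨h1.congr (ae_restrict_of_ae h), ?_⟩
  rw [h2, integral_congr_ae (ae_restrict_of_ae h)]

theorem hasLocACDeriv_of_hasDerivAt {F p : ℝ → ℂ} (h : ∀ x, HasDerivAt F (p x) x)
    (hp : Continuous p) : HasLocACDeriv ℓ F p := fun x _ =>
  ⟨hp.intervalIntegrable _ _, by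
    rw [intervalIntegral.integral_eq_sub_of_hasDerivAt (fun t _ => h t)
      (hp.intervalIntegrable _ _)]; ring⟩

theorem HasLocACDeriv.aestronglyMeasurable (hF : HasLocACDeriv ℓ F p) :
    AEStronglyMeasurable F (linkMeasure ℓ) := by
  refine ContinuousOn.aestronglyMeasurable (fun x hx => ?_) (measurableSet_link ℓ)
  obtain ⟨q, hq1, hq2⟩ := EReal.lt_iff_exists_rat_btwn.1 hx.2
  have hq1' : x < (q : ℝ) := by exact_mod_cast hq1
  have hq : (q : ℝ) ∈ closedLink ℓ := ⟨(hx.1.trans hq1').le, hq2.le⟩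
  exact ((hF.continuousOn_Icc hq).continuousAt (Icc_mem_nhds hx.1 hq1')).continuousWithinAt

end LocAC

/-! ### The form domain and the trace inequality -/

section FormDomain

open scoped InnerProductSpace

variable {N : ℕ} {ℓ : Fin N → EReal}

/-- The ambient Hilbert space of the form domain: a function `ψ` on the graph is recorded by its
value at the vertex and by the three states `ψ'`, `w ψ` and `s ψ`, where `w` and `s` are weights. -/
def FormSpace (ℓ : Fin N → EReal) : Type :=
  WithLp 2 (ℂ × PiLp 2 (fun _ : Fin 3 => StateSpace ℓ))

instance : NormedAddCommGroup (FormSpace ℓ) :=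
  inferInstanceAs (NormedAddCommGroup (WithLp 2 (ℂ × PiLp 2 (fun _ : Fin 3 => StateSpace ℓ))))

instance : InnerProductSpace ℂ (FormSpace ℓ) :=
  inferInstanceAs (InnerProductSpace ℂ (WithLp 2 (ℂ × PiLp 2 (fun _ : Fin 3 => StateSpace ℓ))))

instance : CompleteSpace (FormSpace ℓ) :=
  inferInstanceAs (CompleteSpace (WithLp 2 (ℂ × PiLp 2 (fun _ : Fin 3 => StateSpace ℓ))))

/-- The value at the vertex. -/
def vertex : FormSpace ℓ →L[ℂ] ℂ :=
  (WithLp.fstL 2 ℂ ℂ (PiLp 2 (fun _ : Fin 3 => StateSpace ℓ)) :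
    WithLp 2 (ℂ × PiLp 2 (fun _ : Fin 3 => StateSpace ℓ)) →L[ℂ] ℂ)

/-- The `i`-th of the three states. -/
def stateAt (i : Fin 3) : FormSpace ℓ →L[ℂ] StateSpace ℓ :=
  (PiLp.proj 2 (fun _ : Fin 3 => StateSpace ℓ) i ∘L
    WithLp.sndL 2 ℂ ℂ (PiLp 2 (fun _ : Fin 3 => StateSpace ℓ)) :
    WithLp 2 (ℂ × PiLp 2 (fun _ : Fin 3 => StateSpace ℓ)) →L[ℂ] StateSpace ℓ)

/-- The component of the `i`-th state on the `j`-th link. -/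
def component (i : Fin 3) (j : Fin N) : FormSpace ℓ →L[ℂ] Lp ℂ 2 (linkMeasure (ℓ j)) :=
  PiLp.proj 2 (fun j => Lp ℂ 2 (linkMeasure (ℓ j))) j ∘L stateAt i

theorem inner_formSpace (p q : FormSpace ℓ) :
    ⟪p, q⟫_ℂ = starRingEnd ℂ (vertex p) * vertex q +
      ∑ j, (⟪component 0 j p, component 0 j q⟫_ℂ + ⟪component 1 j p, component 1 j q⟫_ℂ +
        ⟪component 2 j p, component 2 j q⟫_ℂ) := by
  have h1 : ⟪p, q⟫_ℂ = ⟪vertex p, vertex q⟫_ℂ + ∑ i, ⟪stateAt i p, stateAt i q⟫_ℂ := by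
    refine (WithLp.prod_inner_apply (𝕜 := ℂ) (E := ℂ)
      (F := PiLp 2 (fun _ : Fin 3 => StateSpace ℓ)) p q).trans ?_
    rw [PiLp.inner_apply]
    rfl
  have h2 : ∀ i, ⟪stateAt i p, stateAt i q⟫_ℂ = ∑ j, ⟪component i j p, component i j q⟫_ℂ :=
    fun i => PiLp.inner_apply _ _
  rw [h1, Fin.sum_univ_three, h2, h2, h2, ← Finset.sum_add_distrib, ← Finset.sum_add_distrib,
    RCLike.inner_apply, mul_comm]

theorem linkMeasure_Ioc_ne_top (ℓ : EReal) (a b : ℝ) : linkMeasure ℓ (Ioc a b) ≠ ⊤ :=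
  ((Measure.restrict_apply_le _ _).trans_lt measure_Ioc_lt_top).ne

/-- The value at `x`, on the `j`-th link, of the function with the given value at the vertex and the
given derivative. -/
def evalAt (j : Fin N) (x : ℝ) : FormSpace ℓ →L[ℂ] ℂ :=
  vertex +
    innerSL ℂ (indicatorConstLp 2 measurableSet_Ioc
      (linkMeasure_Ioc_ne_top (ℓ j) 0 x) (1 : ℂ)) ∘L component 0 j

theorem evalAt_apply (j : Fin N) (x : ℝ) (p : FormSpace ℓ) :
    evalAt j x p = vertex p + ∫ t in Ioc 0 x, component 0 j p t ∂linkMeasure (ℓ j) := by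
  rw [← L2.inner_indicatorConstLp_one measurableSet_Ioc (linkMeasure_Ioc_ne_top (ℓ j) 0 x)]
  rfl

theorem evalAt_zero (j : Fin N) (p : FormSpace ℓ) : evalAt j 0 p = vertex p := by
  simp [evalAt_apply]

theorem integrableOn_Ioc_of_Lp {ℓ : EReal} (f : Lp ℂ 2 (linkMeasure ℓ)) (a b : ℝ) :
    IntegrableOn f (Ioc a b) (linkMeasure ℓ) := by
  have : IsFiniteMeasure ((linkMeasure ℓ).restrict (Ioc a b)) :=
    ⟨by rw [Measure.restrict_apply_univ]; exact (linkMeasure_Ioc_ne_top ℓ a b).lt_top⟩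
  exact ((Lp.memLp f).restrict (Ioc a b)).integrable one_le_two

theorem hasLocACDeriv_evalAt (j : Fin N) (p : FormSpace ℓ) :
    HasLocACDeriv (ℓ j) (fun x => evalAt j x p) (component 0 j p) := by
  intro x hx
  refine ⟨(intervalIntegrable_iff_integrableOn_linkMeasure hx).2 (integrableOn_Ioc_of_Lp _ _ _), ?_⟩
  simp only
  rw [evalAt_zero, evalAt_apply, intervalIntegral_eq_setIntegral_linkMeasure hx]

/-- Cauchy-Schwarz for `ψ'` against the indicator of `(x, y]`: form functions are Hölder continuous
of exponent `1/2`. -/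
theorem norm_evalAt_sub_le (j : Fin N) {x y : ℝ} (hx : 0 ≤ x) (hxy : x ≤ y) (p : FormSpace ℓ) :
    ‖evalAt j y p - evalAt j x p‖ ≤ Real.sqrt (y - x) * ‖component 0 j p‖ := by
  have e : evalAt j y p - evalAt j x p =
      ⟪indicatorConstLp 2 measurableSet_Ioc (linkMeasure_Ioc_ne_top (ℓ j) x y) (1 : ℂ),
        component 0 j p⟫_ℂ := by
    rw [L2.inner_indicatorConstLp_one, evalAt_apply, evalAt_apply,
      ← Ioc_union_Ioc_eq_Ioc hx hxy, setIntegral_union (Ioc_disjoint_Ioc_of_le le_rfl)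
        measurableSet_Ioc (integrableOn_Ioc_of_Lp _ _ _) (integrableOn_Ioc_of_Lp _ _ _)]
    ring
  rw [e]
  refine (norm_inner_le_norm _ _).trans (mul_le_mul_of_nonneg_right ?_ (norm_nonneg _))
  rw [norm_indicatorConstLp two_ne_zero (by simp), norm_one, one_mul, Real.sqrt_eq_rpow]
  simp only [ENNReal.toReal_ofNat]
  refine Real.rpow_le_rpow measureReal_nonneg ?_ (by norm_num)
  have h1 : (linkMeasure (ℓ j)).real (Ioc x y) ≤ volume.real (Ioc x y) :=
    ENNReal.toReal_mono measure_Ioc_lt_top.ne (Measure.restrict_apply_le _ _)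
  refine h1.trans ?_
  rw [Real.volume_real_Ioc_of_le hxy]

/-- The form domain: the states `(ψ', w ψ, s ψ)` fit together, and `ψ` satisfies the Dirichlet
conditions among the conditions at the ends of the links. -/
def formDomain (ℓ : Fin N → EReal) (ω : Fin N → ℝ) (w : Fin N → ℝ → ℝ) (s : ℝ) :
    Submodule ℂ (FormSpace ℓ) where
  carrier := {p | ∀ j,
    (component 1 j p =ᵐ[linkMeasure (ℓ j)] fun x => (w j x : ℂ) * evalAt j x p) ∧
    (component 2 j p =ᵐ[linkMeasure (ℓ j)] fun x => (s : ℂ) * evalAt j x p) ∧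
    (∀ b : ℝ, ℓ j = b → Real.sin (ω j) = 0 → evalAt j b p = 0)}
  zero_mem' := by
    intro j
    refine ⟨?_, ?_, fun b _ _ => map_zero _⟩ <;>
    · rw [map_zero]
      filter_upwards [Lp.coeFn_zero ℂ 2 (linkMeasure (ℓ j))] with x hx
      simpa using hx
  add_mem' := by
    intro p q hp hq j
    refine ⟨?_, ?_, fun b hb hs => by
      rw [map_add, (hp j).2.2 b hb hs, (hq j).2.2 b hb hs, add_zero]⟩
    · rw [map_add]
      filter_upwards [Lp.coeFn_add (component 1 j p) (component 1 j q), (hp j).1, (hq j).1]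
        with x h1 h2 h3
      rw [h1, Pi.add_apply, h2, h3, map_add, mul_add]
    · rw [map_add]
      filter_upwards [Lp.coeFn_add (component 2 j p) (component 2 j q), (hp j).2.1, (hq j).2.1]
        with x h1 h2 h3
      rw [h1, Pi.add_apply, h2, h3, map_add, mul_add]
  smul_mem' := by
    intro c p hp j
    refine ⟨?_, ?_, fun b hb hs => by rw [map_smul, (hp j).2.2 b hb hs, smul_zero]⟩
    · rw [map_smul]
      filter_upwards [Lp.coeFn_smul c (component 1 j p), (hp j).1] with x h1 h2
      rw [h1, Pi.smul_apply, h2, map_smul, smul_eq_mul, smul_eq_mul]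
      ring
    · rw [map_smul]
      filter_upwards [Lp.coeFn_smul c (component 2 j p), (hp j).2.1] with x h1 h2
      rw [h1, Pi.smul_apply, h2, map_smul, smul_eq_mul, smul_eq_mul]
      ring

/-- The limit in `L²` of functions converging pointwise is the pointwise limit. -/
theorem Lp_limit_ae_eq {μ : Measure ℝ} {f : ℕ → Lp ℂ 2 μ} {g : Lp ℂ 2 μ} {h : ℕ → ℝ → ℂ}
    {k : ℝ → ℂ} (hfg : Tendsto f atTop (𝓝 g)) (hf : ∀ n, f n =ᵐ[μ] h n)
    (hk : ∀ x, Tendsto (fun n => h n x) atTop (𝓝 (k x))) : g =ᵐ[μ] k := by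
  obtain ⟨φ, hφ, hlim⟩ := (tendstoInMeasure_of_tendsto_Lp hfg).exists_seq_tendsto_ae
  filter_upwards [hlim, ae_all_iff.2 hf] with x h1 h2
  refine tendsto_nhds_unique h1 ?_
  simp only [h2]
  exact (hk x).comp hφ.tendsto_atTop

variable {ω : Fin N → ℝ} {w : Fin N → ℝ → ℝ} {s : ℝ}

/-- Point evaluations are continuous on the ambient space and `L²` limits are almost everywhere
limits along a subsequence, so each defining relation survives. Completeness of the form domain
follows. -/
theorem isClosed_formDomain : IsClosed (formDomain ℓ ω w s : Set (FormSpace ℓ)) := by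
  rw [← isSeqClosed_iff_isClosed]
  intro u p hu hup j
  have hev : ∀ x, Tendsto (fun n => evalAt j x (u n)) atTop (𝓝 (evalAt j x p)) := fun x =>
    ((evalAt j x).continuous.tendsto p).comp hup
  have hcomp : ∀ i, Tendsto (fun n => component i j (u n)) atTop (𝓝 (component i j p)) := fun i =>
    ((component i j).continuous.tendsto p).comp hup
  refine ⟨Lp_limit_ae_eq (hcomp 1) (fun n => (hu n j).1) fun x => (hev x).const_mul _,
    Lp_limit_ae_eq (hcomp 2) (fun n => (hu n j).2.1) fun x => (hev x).const_mul _,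
    fun b hb hs => ?_⟩
  refine tendsto_nhds_unique (hev b) ?_
  simp only [(hu _ j).2.2 b hb hs]
  exact tendsto_const_nhds

instance : CompleteSpace (formDomain ℓ ω w s) :=
  isClosed_formDomain.completeSpace_coe

/-- The inclusion of the form domain into the state space. -/
def formInclusion (ℓ : Fin N → EReal) (ω : Fin N → ℝ) (w : Fin N → ℝ → ℝ) (s : ℝ) :
    formDomain ℓ ω w s →L[ℂ] StateSpace ℓ :=
  (s⁻¹ : ℂ) • (stateAt 2 ∘L (formDomain ℓ ω w s).subtypeL)

theorem formInclusion_ae_eq (hs : s ≠ 0) (p : formDomain ℓ ω w s) (j : Fin N) :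
    formInclusion ℓ ω w s p j =ᵐ[linkMeasure (ℓ j)] fun x => evalAt j x (p : FormSpace ℓ) := by
  have e : formInclusion ℓ ω w s p j = (s⁻¹ : ℂ) • component 2 j (p : FormSpace ℓ) := rfl
  rw [e]
  filter_upwards [Lp.coeFn_smul (s⁻¹ : ℂ) (component 2 j (p : FormSpace ℓ)), (p.2 j).2.1]
    with x h1 h2
  rw [h1, Pi.smul_apply, h2, smul_eq_mul, inv_mul_cancel_left₀ (by exact_mod_cast hs)]

theorem memLp_evalAt (hs : s ≠ 0) (p : formDomain ℓ ω w s) (j : Fin N) :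
    MemLp (fun x => evalAt j x (p : FormSpace ℓ)) 2 (linkMeasure (ℓ j)) :=
  (memLp_congr_ae (formInclusion_ae_eq hs p j)).1 (Lp.memLp _)

theorem integrable_conj_mul_Lp {μ : Measure ℝ} (f g : Lp ℂ 2 μ) :
    Integrable (fun x => starRingEnd ℂ (f x) * g x) μ := by
  have := L2.integrable_inner (𝕜 := ℂ) f g
  simpa [RCLike.inner_apply, mul_comm] using this

theorem integrable_formDensity (p q : formDomain ℓ ω w s) (j : Fin N) :
    Integrable (fun x => starRingEnd ℂ (component 0 j (p : FormSpace ℓ) x) *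
        component 0 j (q : FormSpace ℓ) x +
      (((w j x) ^ 2 + s ^ 2 : ℝ) : ℂ) * (starRingEnd ℂ (evalAt j x (p : FormSpace ℓ)) *
        evalAt j x (q : FormSpace ℓ))) (linkMeasure (ℓ j)) := by
  refine (((integrable_conj_mul_Lp (component 0 j (p : FormSpace ℓ)) (component 0 j q)).add
    (integrable_conj_mul_Lp (component 1 j (p : FormSpace ℓ)) (component 1 j q))).add
    (integrable_conj_mul_Lp (component 2 j (p : FormSpace ℓ)) (component 2 j q))).congr ?_
  filter_upwards [(p.2 j).1, (p.2 j).2.1, (q.2 j).1, (q.2 j).2.1] with x h1 h2 h3 h4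
  simp only [Pi.add_apply, h1, h2, h3, h4, map_mul, Complex.conj_ofReal]
  push_cast
  ring

/-- The inner product of the form domain. -/
theorem inner_formDomain (p q : formDomain ℓ ω w s) :
    ⟪p, q⟫_ℂ = starRingEnd ℂ (vertex (p : FormSpace ℓ)) * vertex (q : FormSpace ℓ) +
      ∑ j, ∫ x, (starRingEnd ℂ (component 0 j (p : FormSpace ℓ) x) *
        component 0 j (q : FormSpace ℓ) x +
      (((w j x) ^ 2 + s ^ 2 : ℝ) : ℂ) * (starRingEnd ℂ (evalAt j x (p : FormSpace ℓ)) *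
        evalAt j x (q : FormSpace ℓ))) ∂linkMeasure (ℓ j) := by
  rw [Submodule.coe_inner, inner_formSpace]
  congr 1
  refine Finset.sum_congr rfl fun j _ => ?_
  have hin : ∀ f g : Lp ℂ 2 (linkMeasure (ℓ j)), ⟪f, g⟫_ℂ =
      ∫ x, starRingEnd ℂ (f x) * g x ∂linkMeasure (ℓ j) := fun f g => by
    rw [L2.inner_def]
    simp only [RCLike.inner_apply, mul_comm]
  rw [hin, hin, hin, ← integral_add (integrable_conj_mul_Lp _ _) (integrable_conj_mul_Lp _ _),
    ← integral_add]
  rotate_left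
  · exact (integrable_conj_mul_Lp _ _).add (integrable_conj_mul_Lp _ _)
  · exact integrable_conj_mul_Lp _ _
  refine integral_congr_ae ?_
  filter_upwards [(p.2 j).1, (p.2 j).2.1, (q.2 j).1, (q.2 j).2.1] with x h1 h2 h3 h4
  simp only [h1, h2, h3, h4, map_mul, Complex.conj_ofReal]
  push_cast
  ring

/-- Functions of finite energy define elements of the form domain. -/
theorem exists_mem_formDomain (hℓ : ∀ j, 0 < ℓ j) {f f' : Fin N → ℝ → ℂ} {c : ℂ}
    (hf : ∀ j, HasLocACDeriv (ℓ j) (f j) (f' j)) (hc : ∀ j, f j 0 = c)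
    (h0 : ∀ j, MemLp (f' j) 2 (linkMeasure (ℓ j)))
    (h1 : ∀ j, MemLp (fun x => (w j x : ℂ) * f j x) 2 (linkMeasure (ℓ j)))
    (h2 : ∀ j, MemLp (f j) 2 (linkMeasure (ℓ j)))
    (hD : ∀ j, ∀ b : ℝ, ℓ j = b → Real.sin (ω j) = 0 → f j b = 0) :
    ∃ q : formDomain ℓ ω w s, vertex (q : FormSpace ℓ) = c ∧
      (∀ j, component 0 j (q : FormSpace ℓ) =ᵐ[linkMeasure (ℓ j)] f' j) ∧
      ∀ j, ∀ x ∈ closedLink (ℓ j), evalAt j x (q : FormSpace ℓ) = f j x := by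
  let a : Fin 3 → StateSpace ℓ :=
    ![WithLp.toLp 2 fun j => (h0 j).toLp, WithLp.toLp 2 fun j => (h1 j).toLp,
      WithLp.toLp 2 fun j => ((h2 j).const_mul (s : ℂ)).toLp]
  let q : FormSpace ℓ :=
    (WithLp.toLp 2 (c, WithLp.toLp 2 a) : WithLp 2 (ℂ × PiLp 2 (fun _ : Fin 3 => StateSpace ℓ)))
  have hq0 : ∀ j, component 0 j q =ᵐ[linkMeasure (ℓ j)] f' j := fun j => (h0 j).coeFn_toLp
  have hev : ∀ j, ∀ x ∈ closedLink (ℓ j), evalAt j x q = f j x := by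
    intro j x hx
    rw [evalAt_apply, (hf j x hx).2, hc, intervalIntegral_eq_setIntegral_linkMeasure hx,
      integral_congr_ae (ae_restrict_of_ae (hq0 j))]
    rfl
  have hmem : q ∈ formDomain ℓ ω w s := by
    intro j
    refine ⟨?_, ?_, fun b hb hs => ?_⟩
    · have e : component 1 j q =ᵐ[linkMeasure (ℓ j)] fun x => (w j x : ℂ) * f j x :=
        (h1 j).coeFn_toLp
      filter_upwards [e, ae_restrict_mem (measurableSet_link (ℓ j))] with x e1 hx
      rw [e1, hev j x (link_subset_closedLink hx)]
    · have e : component 2 j q =ᵐ[linkMeasure (ℓ j)] fun x => (s : ℂ) * f j x :=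
        ((h2 j).const_mul (s : ℂ)).coeFn_toLp
      filter_upwards [e, ae_restrict_mem (measurableSet_link (ℓ j))] with x e1 hx
      rw [e1, hev j x (link_subset_closedLink hx)]
    · have hb0 : 0 ≤ b := by
        have := hℓ j
        rw [hb] at this
        exact_mod_cast this.le
      rw [hev j b ⟨hb0, hb.ge⟩, hD j b hb hs]
  exact ⟨⟨q, hmem⟩, rfl, hq0, hev⟩

theorem norm_sq_Lp_eq {μ : Measure ℝ} (f : Lp ℂ 2 μ) : ‖f‖ ^ 2 = ∫ x, ‖f x‖ ^ 2 ∂μ := by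
  have h := L2.inner_def (𝕜 := ℂ) f f
  rw [inner_self_eq_norm_sq_to_K] at h
  have h2 : ∀ x, ⟪f x, f x⟫_ℂ = ((‖f x‖ ^ 2 : ℝ) : ℂ) := fun x => by
    rw [inner_self_eq_norm_sq_to_K]
    norm_cast
  simp only [h2] at h
  rw [integral_complex_ofReal] at h
  refine Complex.ofReal_injective ?_
  rw [Complex.ofReal_pow]
  exact h

theorem sq_norm_component_add_le (p : FormSpace ℓ) (j : Fin N) :
    ‖component 0 j p‖ ^ 2 + ‖component 2 j p‖ ^ 2 ≤ ‖p‖ ^ 2 := by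
  have h1 := congrArg Complex.re (inner_formSpace p p)
  simp only [inner_self_eq_norm_sq_to_K, Complex.add_re, Complex.re_sum] at h1
  have h2 : ∀ r : ℝ, (((r : ℝ) : ℂ) ^ 2).re = r ^ 2 := fun r => by
    rw [← Complex.ofReal_pow, Complex.ofReal_re]
  have h3 : (starRingEnd ℂ (vertex p) * vertex p).re = ‖vertex p‖ ^ 2 := by
    rw [← Complex.normSq_eq_conj_mul_self, Complex.ofReal_re, Complex.normSq_eq_norm_sq]
  simp only [Complex.coe_algebraMap, h2, h3] at h1
  have h4 := Finset.single_le_sum (f := fun j => ‖component 0 j p‖ ^ 2 + ‖component 1 j p‖ ^ 2 +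
    ‖component 2 j p‖ ^ 2) (fun _ _ => by positivity) (Finset.mem_univ j)
  nlinarith [sq_nonneg ‖vertex p‖, sq_nonneg ‖component 1 j p‖]

/-- The trace inequality: point evaluation is small relative to the form norm if the weight `s = 1/L`
is large. -/
theorem sq_norm_evalAt_le {L : ℝ} (hL : 0 < L) (hsL : s * L = 1) {j : Fin N} (hLℓ : (L : EReal) ≤ ℓ j)
    (p : formDomain ℓ ω w s) {x : ℝ} (hx : x ∈ closedLink (ℓ j)) :
    ‖evalAt j x (p : FormSpace ℓ)‖ ^ 2 ≤ 2 * L * ‖p‖ ^ 2 := by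
  set F : ℝ → ℂ := fun y => evalAt j y (p : FormSpace ℓ) with hF
  set b := ‖component 0 j (p : FormSpace ℓ)‖ with hb
  -- A window of length `L` inside the link containing `x`: `[0, L]` if `x ≤ L`, and `[x - L, x]`
  -- otherwise. The pointwise bound `hpt` is averaged over it.
  obtain ⟨a, ha0, haL, hax, hxa⟩ : ∃ a : ℝ, 0 ≤ a ∧ a + L ∈ closedLink (ℓ j) ∧ a ≤ x ∧ x ≤ a + L := by
    rcases le_total x L with h | h
    · exact ⟨0, le_rfl, ⟨by linarith, by rw [zero_add]; exact hLℓ⟩, hx.1, by linarith⟩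
    · exact ⟨x - L, by linarith, by rwa [sub_add_cancel], by linarith, by linarith⟩
  have hpt : ∀ y ∈ Ioc a (a + L), ‖F x‖ ^ 2 ≤ 2 * ‖F y‖ ^ 2 + 2 * L * b ^ 2 := by
    intro y hy
    have h1 : ‖F x - F y‖ ≤ Real.sqrt L * b := by
      rcases le_total x y with h | h
      · rw [norm_sub_rev]
        refine (norm_evalAt_sub_le j hx.1 h (p : FormSpace ℓ)).trans ?_
        gcongr
        linarith [hy.2]
      · refine (norm_evalAt_sub_le j (ha0.trans hy.1.le) h (p : FormSpace ℓ)).trans ?_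
        gcongr
        linarith [hy.1]
    have h2 : ‖F x‖ ≤ ‖F y‖ + Real.sqrt L * b := by
      have := norm_add_le (F y) (F x - F y)
      rw [add_sub_cancel] at this
      linarith
    have h3 : ‖F x‖ ^ 2 ≤ (‖F y‖ + Real.sqrt L * b) ^ 2 :=
      pow_le_pow_left₀ (norm_nonneg _) h2 2
    nlinarith [sq_nonneg (‖F y‖ - Real.sqrt L * b), Real.sq_sqrt hL.le]
  have hvol : (linkMeasure (ℓ j)).restrict (Ioc a (a + L)) = volume.restrict (Ioc a (a + L)) := by
    have := congrArg (fun μ : Measure ℝ => μ.restrict (Ioc a (a + L))) (restrict_linkMeasure_Ioc haL)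
    rwa [Measure.restrict_restrict measurableSet_Ioc, Measure.restrict_restrict measurableSet_Ioc,
      inter_eq_left.2 (Ioc_subset_Ioc_left ha0)] at this
  have hs : s ≠ 0 := by
    rintro rfl
    simp at hsL
  have hint : Integrable (fun y => ‖F y‖ ^ 2) (linkMeasure (ℓ j)) :=
    (memLp_evalAt hs p j).integrable_norm_pow two_ne_zero
  have hd : ‖component 2 j (p : FormSpace ℓ)‖ ^ 2 = s ^ 2 * ∫ y, ‖F y‖ ^ 2 ∂linkMeasure (ℓ j) := by
    rw [norm_sq_Lp_eq, ← integral_const_mul]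
    refine integral_congr_ae ?_
    filter_upwards [(p.2 j).2.1] with y hy
    rw [hy, norm_mul, mul_pow, Complex.norm_real, Real.norm_eq_abs, sq_abs]
  have hI : ∫ y in Ioc a (a + L), ‖F y‖ ^ 2 ∂linkMeasure (ℓ j) ≤
      ∫ y, ‖F y‖ ^ 2 ∂linkMeasure (ℓ j) :=
    setIntegral_le_integral hint (Eventually.of_forall fun y => sq_nonneg _)
  have hconst : ∀ k : ℝ, ∫ _ in Ioc a (a + L), k ∂linkMeasure (ℓ j) = L * k := fun k => by
    rw [hvol, setIntegral_const, Real.volume_real_Ioc_of_le (by linarith), add_sub_cancel_left,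
      smul_eq_mul]
  have hmono : L * ‖F x‖ ^ 2 ≤ 2 * (∫ y in Ioc a (a + L), ‖F y‖ ^ 2 ∂linkMeasure (ℓ j)) +
      L * (2 * L * b ^ 2) := by
    rw [← hconst, ← hconst, ← integral_const_mul, ← integral_add (hint.restrict.const_mul 2)
      (integrableOn_const (linkMeasure_Ioc_ne_top _ _ _))]
    refine setIntegral_mono_on (integrableOn_const (linkMeasure_Ioc_ne_top _ _ _))
      ((hint.restrict.const_mul 2).add (integrableOn_const (linkMeasure_Ioc_ne_top _ _ _)))
      measurableSet_Ioc hpt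
  have hnorm := sq_norm_component_add_le (p : FormSpace ℓ) j
  have hp : ‖(p : FormSpace ℓ)‖ = ‖p‖ := rfl
  rw [hd, hp] at hnorm
  set I := ∫ y, ‖F y‖ ^ 2 ∂linkMeasure (ℓ j) with hIdef
  -- Since `s L = 1`, the mass term `2I` and the derivative term `2 L² b²` are both measured by the
  -- form norm with the same factor `2 L²`.
  have hI2 : I = L ^ 2 * (s ^ 2 * I) := by
    have : s ^ 2 * L ^ 2 = 1 := by rw [← mul_pow, hsL, one_pow]
    linear_combination (-I) * this
  have hfin : L * ‖F x‖ ^ 2 ≤ L * (2 * L * ‖p‖ ^ 2) := by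
    have : L ^ 2 * (b ^ 2 + s ^ 2 * I) ≤ L ^ 2 * ‖p‖ ^ 2 :=
      mul_le_mul_of_nonneg_left hnorm (sq_nonneg L)
    nlinarith
  exact le_of_mul_le_mul_left hfin hL

end FormDomain

/-! ### Bounded sesquilinear forms and their operators -/

section BoundedForms

open scoped InnerProductSpace

variable {Q : Type*} [NormedAddCommGroup Q] [InnerProductSpace ℂ Q]

theorem exists_operator_of_form [CompleteSpace Q] (a : Q → Q → ℂ) (C : ℝ)
    (add_left : ∀ p p' q, a (p + p') q = a p q + a p' q)
    (add_right : ∀ p q q', a p (q + q') = a p q + a p q')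
    (smul_left : ∀ (c : ℂ) p q, a (c • p) q = starRingEnd ℂ c * a p q)
    (smul_right : ∀ (c : ℂ) p q, a p (c • q) = c * a p q)
    (bound : ∀ p q, ‖a p q‖ ≤ C * ‖p‖ * ‖q‖) :
    ∃ T : Q →L[ℂ] Q, ∀ p q, ⟪T p, q⟫_ℂ = a p q :=
  ⟨InnerProductSpace.continuousLinearMapOfBilin (LinearMap.mkContinuous₂
    (LinearMap.mk₂'ₛₗ (starRingEnd ℂ) (RingHom.id ℂ) a add_left smul_left add_right smul_right)
      C bound), fun p q => by
    rw [InnerProductSpace.continuousLinearMapOfBilin_apply]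
    rfl⟩

theorem norm_le_of_norm_inner_le (T : Q →L[ℂ] Q) {C : ℝ} (hC : 0 ≤ C)
    (h : ∀ p q, ‖⟪T p, q⟫_ℂ‖ ≤ C * ‖p‖ * ‖q‖) : ‖T‖ ≤ C := by
  refine T.opNorm_le_bound hC fun p => ?_
  have h1 := h p (T p)
  rw [inner_self_eq_norm_sq_to_K, norm_pow, RCLike.norm_ofReal, abs_norm, sq] at h1
  rcases (norm_nonneg (T p)).eq_or_lt with h0 | h0
  · rw [← h0]
    positivity
  · exact le_of_mul_le_mul_right h1 h0

/-- Testing a form bound with `q = T p` turns it into an operator norm bound, so norm convergence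
reduces to a scalar estimate. -/
theorem tendsto_of_norm_inner_sub_le {ι : Type*} {l : Filter ι} {T : ι → Q →L[ℂ] Q} {S : Q →L[ℂ] Q}
    {δ : ι → ℝ} (hδ : Tendsto δ l (𝓝 0))
    (h : ∀ᶠ i in l, 0 ≤ δ i ∧ ∀ p q, ‖⟪T i p, q⟫_ℂ - ⟪S p, q⟫_ℂ‖ ≤ δ i * ‖p‖ * ‖q‖) :
    Tendsto T l (𝓝 S) := by
  rw [tendsto_iff_norm_sub_tendsto_zero]
  refine squeeze_zero' (Eventually.of_forall fun i => norm_nonneg _) ?_ hδ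
  filter_upwards [h] with i hi
  refine norm_le_of_norm_inner_le _ hi.1 fun p q => ?_
  rw [sub_apply, inner_sub_left]
  exact hi.2 p q

end BoundedForms

/-! ### The perturbing form and its representing operator -/

section Perturbation

open scoped InnerProductSpace

variable {N : ℕ} {ℓ : Fin N → EReal} {ω : Fin N → ℝ} {w : Fin N → ℝ → ℝ} {s κ : ℝ}

/-- Point evaluations on the form domain are bounded by `κ`. -/
def TraceBound (ℓ : Fin N → EReal) (ω : Fin N → ℝ) (w : Fin N → ℝ → ℝ) (s κ : ℝ) : Prop :=
  ∀ (p : formDomain ℓ ω w s) (j : Fin N), ∀ x ∈ closedLink (ℓ j),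
    ‖evalAt j x (p : FormSpace ℓ)‖ ≤ κ * ‖p‖

/-- The form `(α - 1) ψ(0) φ(0) + ∑ⱼ (∫ Uⱼ ψⱼ φⱼ + θⱼ ψⱼ(ℓⱼ) φⱼ(ℓⱼ))`, antilinear in `ψ`. The
summand `- ψ(0) φ(0)` compensates the vertex value in the inner product of the form domain. -/
def pertForm (α : ℝ) (U : Fin N → ℝ → ℝ) (θ : Fin N → ℝ) (p q : FormSpace ℓ) : ℂ :=
  ((α - 1 : ℝ) : ℂ) * (starRingEnd ℂ (vertex p) * vertex q) +
    ∑ j, (∫ x, (U j x : ℂ) * (starRingEnd ℂ (evalAt j x p) * evalAt j x q) ∂linkMeasure (ℓ j) +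
      (θ j : ℂ) * (starRingEnd ℂ (evalAt j (ℓ j).toReal p) * evalAt j (ℓ j).toReal q))

/-- On an infinite link `toReal` returns `0`, so the end term of `pertForm` is then evaluated at the
vertex; `endCoeff` gives it the coefficient zero. -/
theorem toReal_mem_closedLink {ℓ : EReal} (hℓ : 0 < ℓ) : ℓ.toReal ∈ closedLink ℓ := by
  refine ⟨EReal.toReal_nonneg hℓ.le, ?_⟩
  induction ℓ with
  | bot => simp at hℓ
  | top => exact le_top
  | coe x => simp

theorem integrable_potential_mul (hκ : TraceBound ℓ ω w s κ) {j : Fin N} {U : ℝ → ℝ}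
    (hU : Integrable U (linkMeasure (ℓ j))) (p q : formDomain ℓ ω w s) :
    Integrable (fun x => (U x : ℂ) * (starRingEnd ℂ (evalAt j x (p : FormSpace ℓ)) *
      evalAt j x (q : FormSpace ℓ))) (linkMeasure (ℓ j)) := by
  have hp := hasLocACDeriv_evalAt j (p : FormSpace ℓ)
  have hq := hasLocACDeriv_evalAt j (q : FormSpace ℓ)
  refine (hU.ofReal (𝕜 := ℂ)).mul_bdd (c := κ * ‖p‖ * (κ * ‖q‖))
    (hp.conj.aestronglyMeasurable.mul hq.aestronglyMeasurable) ?_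
  filter_upwards [ae_restrict_mem (measurableSet_link (ℓ j))] with x hx
  rw [norm_mul, RCLike.norm_conj]
  have h1 := hκ p j x (link_subset_closedLink hx)
  exact mul_le_mul h1 (hκ q j x (link_subset_closedLink hx)) (norm_nonneg _)
    ((norm_nonneg _).trans h1)

theorem norm_integral_potential_mul_le (hκ : TraceBound ℓ ω w s κ) {j : Fin N} {U : ℝ → ℝ}
    (hU : Integrable U (linkMeasure (ℓ j))) (p q : formDomain ℓ ω w s) :
    ‖∫ x, (U x : ℂ) * (starRingEnd ℂ (evalAt j x (p : FormSpace ℓ)) *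
      evalAt j x (q : FormSpace ℓ)) ∂linkMeasure (ℓ j)‖ ≤
    (∫ x, |U x| ∂linkMeasure (ℓ j)) * κ ^ 2 * ‖p‖ * ‖q‖ := by
  have e : (∫ x, |U x| ∂linkMeasure (ℓ j)) * κ ^ 2 * ‖p‖ * ‖q‖ =
      ∫ x, |U x| * (κ ^ 2 * ‖p‖ * ‖q‖) ∂linkMeasure (ℓ j) := by
    rw [integral_mul_const]
    ring
  rw [e]
  refine norm_integral_le_of_norm_le (hU.abs.mul_const _) ?_
  filter_upwards [ae_restrict_mem (measurableSet_link (ℓ j))] with x hx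
  rw [norm_mul, norm_mul, RCLike.norm_conj, Complex.norm_real, Real.norm_eq_abs]
  refine mul_le_mul_of_nonneg_left ?_ (abs_nonneg _)
  have h1 := hκ p j x (link_subset_closedLink hx)
  refine (mul_le_mul h1 (hκ q j x (link_subset_closedLink hx)) (norm_nonneg _)
    ((norm_nonneg _).trans h1)).trans_eq ?_
  ring

theorem norm_conj_mul_evalAt_le (hκ : TraceBound ℓ ω w s κ) {j : Fin N} {x : ℝ}
    (hx : x ∈ closedLink (ℓ j)) (p q : formDomain ℓ ω w s) :
    ‖starRingEnd ℂ (evalAt j x (p : FormSpace ℓ)) * evalAt j x (q : FormSpace ℓ)‖ ≤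
      κ ^ 2 * ‖p‖ * ‖q‖ := by
  rw [norm_mul, RCLike.norm_conj]
  have h1 := hκ p j x hx
  refine (mul_le_mul h1 (hκ q j x hx) (norm_nonneg _) ((norm_nonneg _).trans h1)).trans_eq ?_
  ring

/-- Every term is a product of two point evaluations, each costing a factor `κ`; the vertex value is
the evaluation at `0` on any one link. The factor `κ²` later makes the operator a contraction. -/
theorem norm_pertForm_le (hN : 0 < N) (hℓ : ∀ j, 0 < ℓ j) (hκ : TraceBound ℓ ω w s κ) {α : ℝ}
    {U : Fin N → ℝ → ℝ} (hU : ∀ j, Integrable (U j) (linkMeasure (ℓ j))) {θ : Fin N → ℝ}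
    (p q : formDomain ℓ ω w s) :
    ‖pertForm α U θ (p : FormSpace ℓ) q‖ ≤
      (|α - 1| + ∑ j, (∫ x, |U j x| ∂linkMeasure (ℓ j) + |θ j|)) * κ ^ 2 * ‖p‖ * ‖q‖ := by
  have h0 := norm_conj_mul_evalAt_le hκ (zero_mem_closedLink (hℓ ⟨0, hN⟩)) p q
  rw [evalAt_zero, evalAt_zero] at h0
  unfold pertForm
  have e : (|α - 1| + ∑ j, (∫ x, |U j x| ∂linkMeasure (ℓ j) + |θ j|)) * κ ^ 2 * ‖p‖ * ‖q‖ =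
      |α - 1| * (κ ^ 2 * ‖p‖ * ‖q‖) + ∑ j, ((∫ x, |U j x| ∂linkMeasure (ℓ j)) * κ ^ 2 * ‖p‖ * ‖q‖ +
        |θ j| * (κ ^ 2 * ‖p‖ * ‖q‖)) := by
    simp only [add_mul, Finset.sum_mul]
    simp only [mul_assoc]
  rw [e]
  refine (norm_add_le _ _).trans (add_le_add ?_ ?_)
  · rw [norm_mul, Complex.norm_real, Real.norm_eq_abs]
    exact mul_le_mul_of_nonneg_left h0 (abs_nonneg _)
  · refine (norm_sum_le _ _).trans (Finset.sum_le_sum fun j _ => ?_)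
    refine (norm_add_le _ _).trans (add_le_add (norm_integral_potential_mul_le hκ (hU j) p q) ?_)
    rw [norm_mul, Complex.norm_real, Real.norm_eq_abs]
    exact mul_le_mul_of_nonneg_left
      (norm_conj_mul_evalAt_le hκ (toReal_mem_closedLink (hℓ j)) p q) (abs_nonneg _)

theorem conj_pertForm (α : ℝ) (U : Fin N → ℝ → ℝ) (θ : Fin N → ℝ) (p q : FormSpace ℓ) :
    starRingEnd ℂ (pertForm α U θ p q) = pertForm α U θ q p := by
  simp only [pertForm, map_add, map_mul, map_sum, Complex.conj_conj, Complex.conj_ofReal,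
    ← integral_conj, mul_comm]

/-- The bounded self-adjoint operator on the form domain representing `pertForm`. -/
theorem exists_pertOperator (hN : 0 < N) (hℓ : ∀ j, 0 < ℓ j) (hκ : TraceBound ℓ ω w s κ) (α : ℝ)
    {U : Fin N → ℝ → ℝ} (hU : ∀ j, Integrable (U j) (linkMeasure (ℓ j))) (θ : Fin N → ℝ) :
    ∃ T : formDomain ℓ ω w s →L[ℂ] formDomain ℓ ω w s, IsSelfAdjoint T ∧
      ‖T‖ ≤ (|α - 1| + ∑ j, (∫ x, |U j x| ∂linkMeasure (ℓ j) + |θ j|)) * κ ^ 2 ∧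
      ∀ p q, ⟪T p, q⟫_ℂ = pertForm α U θ (p : FormSpace ℓ) q := by
  have addr : ∀ p q q' : formDomain ℓ ω w s, pertForm α U θ (p : FormSpace ℓ) (q + q' : FormSpace ℓ)
      = pertForm α U θ (p : FormSpace ℓ) q + pertForm α U θ (p : FormSpace ℓ) q' := by
    intro p q q'
    have hi : ∀ j, ∫ x, ((U j x : ℂ) * (starRingEnd ℂ (evalAt j x (p : FormSpace ℓ)) *
        evalAt j x (q : FormSpace ℓ)) + (U j x : ℂ) * (starRingEnd ℂ (evalAt j x (p : FormSpace ℓ)) *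
        evalAt j x (q' : FormSpace ℓ))) ∂linkMeasure (ℓ j) = _ := fun j =>
      integral_add (integrable_potential_mul hκ (hU j) p q)
        (integrable_potential_mul hκ (hU j) p q')
    simp only [pertForm, map_add, mul_add, hi, Finset.sum_add_distrib]
    ring
  have smulr : ∀ (c : ℂ) (p q : formDomain ℓ ω w s), pertForm α U θ (p : FormSpace ℓ)
      (c • q : FormSpace ℓ) = c * pertForm α U θ (p : FormSpace ℓ) q := by
    intro c p q
    simp only [pertForm, map_smul, smul_eq_mul, mul_add, Finset.mul_sum,
      ← integral_const_mul]
    congr 1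
    · ring
    · refine Finset.sum_congr rfl fun j _ => ?_
      congr 1
      · refine integral_congr_ae (Eventually.of_forall fun x => ?_)
        simp only
        ring
      · ring
  obtain ⟨T, hT⟩ := exists_operator_of_form
    (fun p q : formDomain ℓ ω w s => pertForm α U θ (p : FormSpace ℓ) q) _
    -- Linearity properties in the first argument follow from those in the second by Hermitian
    -- symmetry.
    (fun p p' q => by
      rw [← conj_pertForm, ← conj_pertForm (p := (q : FormSpace ℓ)) (q := (p : FormSpace ℓ)),
        ← conj_pertForm (p := (q : FormSpace ℓ)) (q := (p' : FormSpace ℓ)), ← map_add, ← addr]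
      rfl)
    (fun p q q' => addr p q q')
    (fun c p q => by
      rw [← conj_pertForm, ← conj_pertForm (p := (q : FormSpace ℓ)) (q := (p : FormSpace ℓ)),
        ← map_mul, ← smulr]
      rfl)
    (fun c p q => smulr c p q)
    (fun p q => norm_pertForm_le hN hℓ hκ hU p q)
  refine ⟨T, ?_, norm_le_of_norm_inner_le T ?_ fun p q => ?_, hT⟩
  · rw [ContinuousLinearMap.isSelfAdjoint_iff_isSymmetric]
    intro p q
    simp only [ContinuousLinearMap.coe_coe]
    rw [hT, ← inner_conj_symm, hT, conj_pertForm]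
  · have : ∀ j, 0 ≤ ∫ x, |U j x| ∂linkMeasure (ℓ j) := fun j =>
      integral_nonneg fun x => abs_nonneg _
    exact mul_nonneg (add_nonneg (abs_nonneg _) (Finset.sum_nonneg fun j _ =>
      add_nonneg (this j) (abs_nonneg _))) (sq_nonneg κ)
  · rw [hT]
    exact norm_pertForm_le hN hℓ hκ hU p q

end Perturbation

/-! ### The energy form written out -/

section Energy

open scoped InnerProductSpace

variable {N : ℕ} {ℓ : Fin N → EReal} {ω : Fin N → ℝ} {V : Fin N → ℝ → ℝ} {m s κ : ℝ}

/-- The weight `√(V - m)` of the form domain of a potential `V ≥ m`. -/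
def formWeight (V : Fin N → ℝ → ℝ) (m : ℝ) : Fin N → ℝ → ℝ := fun j x => Real.sqrt (V j x - m)

/-- The energy form `⟪(1 + T) p, q⟫` written out. -/
theorem inner_add_pertForm (hm : ∀ j, ∀ᵐ x ∂linkMeasure (ℓ j), m ≤ V j x)
    (hκ : TraceBound ℓ ω (formWeight V m) s κ) (α : ℝ) {U : Fin N → ℝ → ℝ}
    (hU : ∀ j, Integrable (U j) (linkMeasure (ℓ j))) (θ : Fin N → ℝ)
    (p q : formDomain ℓ ω (formWeight V m) s) :
    ⟪p, q⟫_ℂ + pertForm α U θ (p : FormSpace ℓ) q =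
      (α : ℂ) * (starRingEnd ℂ (vertex (p : FormSpace ℓ)) * vertex (q : FormSpace ℓ)) +
      ∑ j, (∫ x, (starRingEnd ℂ (component 0 j (p : FormSpace ℓ) x) *
          component 0 j (q : FormSpace ℓ) x + ((V j x + U j x - m + s ^ 2 : ℝ) : ℂ) *
        (starRingEnd ℂ (evalAt j x (p : FormSpace ℓ)) * evalAt j x (q : FormSpace ℓ)))
          ∂linkMeasure (ℓ j) +
      (θ j : ℂ) * (starRingEnd ℂ (evalAt j (ℓ j).toReal (p : FormSpace ℓ)) *
        evalAt j (ℓ j).toReal (q : FormSpace ℓ))) ∧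
    ∀ j, Integrable (fun x => starRingEnd ℂ (component 0 j (p : FormSpace ℓ) x) *
          component 0 j (q : FormSpace ℓ) x + ((V j x + U j x - m + s ^ 2 : ℝ) : ℂ) *
        (starRingEnd ℂ (evalAt j x (p : FormSpace ℓ)) * evalAt j x (q : FormSpace ℓ)))
          (linkMeasure (ℓ j)) := by
  have hae : ∀ j, (fun x => (starRingEnd ℂ (component 0 j (p : FormSpace ℓ) x) *
        component 0 j (q : FormSpace ℓ) x + (((formWeight V m j x) ^ 2 + s ^ 2 : ℝ) : ℂ) *
        (starRingEnd ℂ (evalAt j x (p : FormSpace ℓ)) * evalAt j x (q : FormSpace ℓ))) +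
        (U j x : ℂ) * (starRingEnd ℂ (evalAt j x (p : FormSpace ℓ)) *
          evalAt j x (q : FormSpace ℓ))) =ᵐ[linkMeasure (ℓ j)]
      fun x => starRingEnd ℂ (component 0 j (p : FormSpace ℓ) x) *
          component 0 j (q : FormSpace ℓ) x + ((V j x + U j x - m + s ^ 2 : ℝ) : ℂ) *
        (starRingEnd ℂ (evalAt j x (p : FormSpace ℓ)) * evalAt j x (q : FormSpace ℓ)) := by
    intro j
    -- The bound `m ≤ V` enters here: it makes the square of the weight equal to `V - m`.
    filter_upwards [hm j] with x hx
    rw [formWeight, Real.sq_sqrt (by linarith)]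
    push_cast
    ring
  refine ⟨?_, fun j => ((integrable_formDensity p q j).add
    (integrable_potential_mul hκ (hU j) p q)).congr (hae j)⟩
  rw [inner_formDomain, pertForm]
  have hj : ∀ j, _ = ∫ x, _ ∂linkMeasure (ℓ j) := fun j => (integral_add
    (integrable_formDensity p q j) (integrable_potential_mul hκ (hU j) p q)).symm.trans
    (integral_congr_ae (hae j))
  simp only [← hj, Finset.sum_add_distrib]
  push_cast
  ring

end Energy

/-! ### Test functions and integration by parts -/

section TestFunctions

variable {ℓ : EReal} {F p D r : ℝ → ℂ}

theorem intervalIntegrable_of_locallyIntegrableOn {V : ℝ → ℝ}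
    (hV : LocallyIntegrableOn V (closedLink ℓ) volume) {x : ℝ} (hx : x ∈ closedLink ℓ) :
    IntervalIntegrable V volume 0 x := by
  rw [intervalIntegrable_iff_integrableOn_Icc_of_le hx.1]
  exact hV.integrableOn_compact_subset (Icc_subset_closedLink hx) isCompact_Icc

theorem intervalIntegrable_of_integrable_linkMeasure {E : Type*} [NormedAddCommGroup E] {U : ℝ → E}
    (hU : Integrable U (linkMeasure ℓ)) {x : ℝ} (hx : x ∈ closedLink ℓ) :
    IntervalIntegrable U volume 0 x :=
  (intervalIntegrable_iff_integrableOn_linkMeasure hx).2 hU.integrableOn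

theorem HasLocACDeriv.intervalIntegrable_mul (hF : HasLocACDeriv ℓ F p) {x : ℝ}
    (hx : x ∈ closedLink ℓ) {u : ℝ → ℂ} (hu : IntervalIntegrable u volume 0 x) :
    IntervalIntegrable (fun t => u t * F t) volume 0 x := by
  refine hu.mul_continuousOn ?_
  rw [uIcc_of_le hx.1]
  exact hF.continuousOn_Icc hx

theorem HasLocACDeriv.memLp_of_vanish (hF : HasLocACDeriv ℓ F p) {x : ℝ} (hx : x ∈ closedLink ℓ)
    (h0 : ∀ t ∈ link ℓ, x < t → F t = 0) : MemLp F 2 (linkMeasure ℓ) := by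
  rw [memLp_two_iff_integrable_sq_norm hF.aestronglyMeasurable]
  refine integrable_linkMeasure_of_intervalIntegrable hx ?_ fun t ht hxt => by simp [h0 t ht hxt]
  refine ContinuousOn.intervalIntegrable ?_
  rw [uIcc_of_le hx.1]
  exact (hF.continuousOn_Icc hx).norm.pow 2

/-- The squared modulus is `max (V - m) 0 * ‖F‖²`, a locally integrable function times one that is
continuous on `[0, x]` and vanishes beyond `x`. -/
theorem HasLocACDeriv.memLp_weight_mul_of_vanish (hF : HasLocACDeriv ℓ F p) {x : ℝ}
    (hx : x ∈ closedLink ℓ) (h0 : ∀ t ∈ link ℓ, x < t → F t = 0) {V : ℝ → ℝ}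
    (hV : LocallyIntegrableOn V (closedLink ℓ) volume) (m : ℝ) :
    MemLp (fun t => (Real.sqrt (V t - m) : ℂ) * F t) 2 (linkMeasure ℓ) := by
  have hVm : AEStronglyMeasurable V (linkMeasure ℓ) :=
    hV.aestronglyMeasurable.mono_set link_subset_closedLink
  have hw : AEStronglyMeasurable (fun t => (Real.sqrt (V t - m) : ℂ)) (linkMeasure ℓ) :=
    (Complex.continuous_ofReal.comp Real.continuous_sqrt).comp_aestronglyMeasurable
      (hVm.sub aestronglyMeasurable_const)
  refine (memLp_two_iff_integrable_sq_norm (hw.mul hF.aestronglyMeasurable)).2 ?_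
  have e : ∀ t, ‖(Real.sqrt (V t - m) : ℂ) * F t‖ ^ 2 = max (V t - m) 0 * ‖F t‖ ^ 2 := by
    intro t
    rw [norm_mul, mul_pow, Complex.norm_real, Real.norm_eq_abs, sq_abs, Real.sq_sqrt']
  simp only [Pi.mul_apply, e]
  refine integrable_linkMeasure_of_intervalIntegrable hx ?_ fun t ht hxt => by simp [h0 t ht hxt]
  have hi := (intervalIntegrable_of_locallyIntegrableOn hV hx).sub
    (intervalIntegrable_const (c := m))
  have hi' : IntervalIntegrable (fun t => max (V t - m) 0) volume 0 x :=
    ⟨hi.1.pos_part, hi.2.pos_part⟩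
  refine hi'.mul_continuousOn ?_
  rw [uIcc_of_le hx.1]
  exact (hF.continuousOn_Icc hx).norm.pow 2

/-- Integration by parts against a test function. -/
theorem HasLocACDeriv.integral_conj_mul (hD : HasLocACDeriv ℓ D r) (hF : HasLocACDeriv ℓ F p) {x : ℝ}
    (hx : x ∈ closedLink ℓ) :
    IntervalIntegrable (fun t => starRingEnd ℂ (D t) * p t + starRingEnd ℂ (r t) * F t) volume 0 x ∧
    ∫ t in (0 : ℝ)..x, (starRingEnd ℂ (D t) * p t + starRingEnd ℂ (r t) * F t) =
      starRingEnd ℂ (D x) * F x - starRingEnd ℂ (D 0) * F 0 := by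
  obtain ⟨h1, h2⟩ := hD.conj.mul hF x hx
  have e : (fun t => starRingEnd ℂ (r t) * F t + starRingEnd ℂ (D t) * p t) =
      fun t => starRingEnd ℂ (D t) * p t + starRingEnd ℂ (r t) * F t :=
    funext fun t => add_comm _ _
  rw [e] at h1 h2
  exact ⟨h1, by rw [eq_sub_iff_add_eq', ← h2]⟩

theorem hasLocACDeriv_integral {f' : ℝ → ℂ}
    (h : ∀ x ∈ closedLink ℓ, IntervalIntegrable f' volume 0 x) (k : ℂ) :
    HasLocACDeriv ℓ (fun x => k + ∫ t in (0 : ℝ)..x, f' t) f' := fun x hx =>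
  ⟨h x hx, by simp⟩

end TestFunctions

/-! ### Regularity of weak solutions -/

section Regularity

variable {N : ℕ} {ℓ : Fin N → EReal} {ω : Fin N → ℝ}

/-- The coefficient `cot ω` of the boundary term of the energy at the end of a link; it is `0` for
Dirichlet conditions and for infinite links. -/
def endCoeff (ℓ : EReal) (ω : ℝ) : ℝ := if ℓ = ⊤ then 0 else Real.cos ω / Real.sin ω

/-- The functions `F j` with derivatives `b j` solve `F'' = r` weakly, with coupling `α` at the
vertex and the boundary conditions given by `ω`. -/
def IsWeakSolution (ℓ : Fin N → EReal) (ω : Fin N → ℝ) (α : ℝ) (F b r : Fin N → ℝ → ℂ) (c : ℂ) :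
    Prop :=
  ∀ (f f' : Fin N → ℝ → ℂ) (c' : ℂ) (x : Fin N → ℝ), (∀ j, x j ∈ closedLink (ℓ j)) →
    (∀ j, HasLocACDeriv (ℓ j) (f j) (f' j)) → (∀ j, f j 0 = c') →
    (∀ j, ∀ t ∈ link (ℓ j), x j < t → f j t = 0 ∧ f' j t = 0) →
    (∀ j, MemLp (f' j) 2 (linkMeasure (ℓ j))) →
    (∀ j, ∀ e : ℝ, ℓ j = e → Real.sin (ω j) = 0 → f j e = 0) →
    (α : ℂ) * (starRingEnd ℂ c * c') + ∑ j, ((∫ t in (0 : ℝ)..(x j), (starRingEnd ℂ (b j t) * f' j t +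
      starRingEnd ℂ (r j t) * f j t)) + (endCoeff (ℓ j) (ω j) : ℂ) *
        (starRingEnd ℂ (F j (ℓ j).toReal) * f j (ℓ j).toReal)) = 0

variable {α : ℝ} {F b r : Fin N → ℝ → ℂ} {c : ℂ}

/-- The weak equation for a test function supported on one link. -/
theorem IsWeakSolution.single (h : IsWeakSolution ℓ ω α F b r c) (hℓ : ∀ j, 0 < ℓ j) (j : Fin N)
    {f f' : ℝ → ℂ} {x : ℝ} (hx : x ∈ closedLink (ℓ j)) (hf : HasLocACDeriv (ℓ j) f f')
    (h0 : f 0 = 0) (hv : ∀ t ∈ link (ℓ j), x < t → f t = 0 ∧ f' t = 0)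
    (hf' : MemLp f' 2 (linkMeasure (ℓ j)))
    (hD : ∀ e : ℝ, ℓ j = e → Real.sin (ω j) = 0 → f e = 0) :
    (∫ t in (0 : ℝ)..x, (starRingEnd ℂ (b j t) * f' t + starRingEnd ℂ (r j t) * f t)) +
      (endCoeff (ℓ j) (ω j) : ℂ) * (starRingEnd ℂ (F j (ℓ j).toReal) * f (ℓ j).toReal) = 0 := by
  classical
  have key := h (fun i => if i = j then f else 0) (fun i => if i = j then f' else 0) 0
    (fun i => if i = j then x else 0)
    (fun i => by
      by_cases hi : i = j
      · subst hi; simpa using hx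
      · simpa [hi] using zero_mem_closedLink (hℓ i))
    (fun i => by
      by_cases hi : i = j
      · subst hi; simpa using hf
      · simpa [hi] using HasLocACDeriv.zero (ℓ i))
    (fun i => by
      by_cases hi : i = j
      · subst hi; simpa using h0
      · simp [hi])
    (fun i t ht hxt => by
      by_cases hi : i = j
      · subst hi
        simpa using hv t ht (by simpa using hxt)
      · simp [hi])
    (fun i => by
      by_cases hi : i = j
      · subst hi; simpa using hf'
      · simp [hi])
    (fun i e he hs => by
      by_cases hi : i = j
      · subst hi; simpa using hD e he hs
      · simp [hi])
  rw [mul_zero, mul_zero, zero_add, Finset.sum_eq_single j (fun i _ hi => by simp [hi])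
    (fun h => absurd (Finset.mem_univ j) h)] at key
  simpa using key

/-- The derivative `b` of a weak solution differs from a primitive of `r` by a constant: the
difference is orthogonal to all functions of mean zero. -/
theorem IsWeakSolution.sub_ae_eq_const (h : IsWeakSolution ℓ ω α F b r c) (hℓ : ∀ j, 0 < ℓ j)
    (j : Fin N) (hb : MemLp (b j) 2 (linkMeasure (ℓ j))) {G : ℝ → ℂ}
    (hG : HasLocACDeriv (ℓ j) G (r j)) {x : ℝ} (hx : x ∈ closedLink (ℓ j)) (hx0 : 0 < x) :
    ∃ k : ℂ, ∀ᵐ t, t ∈ Ioc 0 x → b j t - G t = k := by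
  set μ := volume.restrict (Ioc 0 x) with hμ
  have hμr : (linkMeasure (ℓ j)).restrict (Ioc 0 x) = μ := restrict_linkMeasure_Ioc hx
  have hbμ : MemLp (b j) 2 μ := by
    rw [← hμr]
    exact hb.restrict _
  have hGμ : MemLp G 2 μ := by
    obtain ⟨C, hC⟩ := isCompact_Icc.exists_bound_of_continuousOn (hG.continuousOn_Icc hx)
    refine MemLp.of_bound (C := C) ?_ ?_
    · exact ((hG.continuousOn_Icc hx).mono Ioc_subset_Icc_self).aestronglyMeasurable
        measurableSet_Ioc
    · filter_upwards [ae_restrict_mem measurableSet_Ioc] with t ht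
      exact hC t (Ioc_subset_Icc_self ht)
  -- `M` is the mean of `b - G` on `(0, x]`, the only possible value of the constant; the aim is to
  -- show that the mean-free part `η` vanishes.
  set M : ℂ := (∫ t, (b j t - G t) ∂μ) / x with hM
  set η : ℝ → ℂ := fun t => b j t - G t - M with hη
  have hηL : MemLp η 2 μ := (hbμ.sub hGμ).sub (memLp_const M)
  have hηi : Integrable η μ := hηL.integrable one_le_two
  have hη0 : ∫ t, η t ∂μ = 0 := by
    have h1 : Integrable (fun t => b j t - G t) μ := (hbμ.sub hGμ).integrable one_le_two
    rw [hη, integral_sub h1 (integrable_const M), integral_const, measureReal_restrict_apply_univ,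
      Real.volume_real_Ioc_of_le hx0.le, sub_zero, Complex.real_smul, hM,
      mul_div_cancel₀ _ (by exact_mod_cast hx0.ne'), sub_self]
  -- The primitive of `η` vanishes at the vertex and, since `η` has mean zero, from `x` on. It is
  -- admissible whatever the end condition, and the end term drops out.
  set f' : ℝ → ℂ := (Ioc 0 x).indicator η with hf'
  set f : ℝ → ℂ := fun u => 0 + ∫ t in (0 : ℝ)..u, f' t with hf
  have hf'i : Integrable f' volume := (integrable_indicator_iff measurableSet_Ioc).2 hηi
  have hfac : HasLocACDeriv (ℓ j) f f' :=
    hasLocACDeriv_integral (fun u _ => hf'i.intervalIntegrable) 0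
  have hfv : ∀ u, x ≤ u → f u = 0 := by
    intro u hu
    simp only [hf, zero_add]
    rw [intervalIntegral.integral_of_le (hx0.le.trans hu), hf',
      setIntegral_indicator measurableSet_Ioc,
      inter_eq_right.2 (Ioc_subset_Ioc_right hu), hη0]
  have hlast : ∀ e : ℝ, ℓ j = e → f e = 0 := fun e he => by
    refine hfv e ?_
    have := hx.2
    rw [he] at this
    exact_mod_cast this
  have key := h.single hℓ j hx hfac (by simp [hf])
    (fun t _ ht => ⟨hfv t ht.le, indicator_of_notMem (fun h => absurd h.2 (not_le.2 ht)) _⟩)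
    ((memLp_indicator_iff_restrict measurableSet_Ioc).2 (by rw [hμr]; exact hηL))
    (fun e he _ => hlast e he)
  have hend : (endCoeff (ℓ j) (ω j) : ℂ) * (starRingEnd ℂ (F j (ℓ j).toReal) * f (ℓ j).toReal) = 0 := by
    rcases eq_or_ne (ℓ j) ⊤ with ht | ht
    · simp [endCoeff, ht]
    · rw [hlast _ (EReal.coe_toReal ht (hℓ j).ne_bot).symm, mul_zero, mul_zero]
  rw [hend, add_zero] at key
  obtain ⟨hi2, hG2⟩ := hG.integral_conj_mul hfac hx
  rw [hfv x le_rfl, show f 0 = 0 by simp [hf], mul_zero, mul_zero, sub_zero] at hG2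
  rw [intervalIntegral.integral_of_le hx0.le] at key hG2
  rw [intervalIntegrable_iff_integrableOn_Ioc_of_le hx0.le] at hi2
  have hbη : Integrable (fun t => starRingEnd ℂ (b j t - G t) * η t) μ := by
    have h1 : MemLp (fun t => starRingEnd ℂ (b j t - G t)) 2 μ := (hbμ.sub hGμ).star
    exact h1.integrable_mul hηL
  -- The weak equation minus integration by parts for `G`, whose boundary terms vanish.
  have e1 : ∫ t, starRingEnd ℂ (b j t - G t) * η t ∂μ = 0 := by
    have h1 : ∫ t in Ioc 0 x, (starRingEnd ℂ (b j t) * f' t + starRingEnd ℂ (r j t) * f t) =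
        ∫ t in Ioc 0 x, (starRingEnd ℂ (b j t - G t) * η t +
          (starRingEnd ℂ (G t) * f' t + starRingEnd ℂ (r j t) * f t)) := by
      refine setIntegral_congr_fun measurableSet_Ioc fun t ht => ?_
      simp only [hf', indicator_of_mem ht, map_sub]
      ring
    rw [h1, integral_add hbη hi2, hG2, add_zero] at key
    exact key
  -- Here `η = b - G - M`, and the constant `M` is orthogonal to `η`.
  have e2 : ∫ t, ‖η t‖ ^ 2 ∂μ = 0 := by
    have h1 : ∫ t, ((‖η t‖ ^ 2 : ℝ) : ℂ) ∂μ = ∫ t, (starRingEnd ℂ (b j t - G t) * η t -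
        starRingEnd ℂ M * η t) ∂μ := by
      refine integral_congr_ae (Eventually.of_forall fun t => ?_)
      simp only
      rw [← Complex.normSq_eq_norm_sq, Complex.normSq_eq_conj_mul_self, ← sub_mul, ← map_sub]
    rw [integral_sub hbη (hηi.const_mul _), e1, integral_const_mul, hη0, mul_zero, sub_zero,
      integral_complex_ofReal] at h1
    exact_mod_cast h1
  have e3 := (integral_eq_zero_iff_of_nonneg (fun t => sq_nonneg ‖η t‖)
    (hηL.integrable_norm_pow two_ne_zero)).1 e2
  refine ⟨M, (ae_restrict_iff' measurableSet_Ioc).1 ?_⟩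
  filter_upwards [e3] with t ht
  have : ‖η t‖ = 0 := by simpa using ht
  rw [norm_eq_zero] at this
  exact sub_eq_zero.1 this

/-- A weak solution has a locally absolutely continuous derivative. -/
theorem IsWeakSolution.exists_deriv (h : IsWeakSolution ℓ ω α F b r c) (hℓ : ∀ j, 0 < ℓ j)
    (j : Fin N) (hb : MemLp (b j) 2 (linkMeasure (ℓ j)))
    (hr : ∀ x ∈ closedLink (ℓ j), IntervalIntegrable (r j) volume 0 x) :
    ∃ D : ℝ → ℂ, HasLocACDeriv (ℓ j) D (r j) ∧ b j =ᵐ[linkMeasure (ℓ j)] D := by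
  set G : ℝ → ℂ := fun x => 0 + ∫ t in (0 : ℝ)..x, r j t with hGdef
  have hG : HasLocACDeriv (ℓ j) G (r j) := hasLocACDeriv_integral hr 0
  obtain ⟨y, hy0, hy⟩ : ∃ y : ℝ, 0 < y ∧ y ∈ closedLink (ℓ j) := by
    obtain ⟨q, hq1, hq2⟩ := EReal.lt_iff_exists_rat_btwn.1 (hℓ j)
    have hq1' : (0 : ℝ) < (q : ℝ) := by exact_mod_cast hq1
    exact ⟨q, hq1', hq1'.le, hq2.le⟩
  obtain ⟨k, hk⟩ := h.sub_ae_eq_const hℓ j hb hG hy hy0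
  refine ⟨fun x => k + ∫ t in (0 : ℝ)..x, r j t, hasLocACDeriv_integral hr k, ?_⟩
  refine ae_linkMeasure_of_ae_Ioo fun x hx => ?_
  rcases hx.1.eq_or_lt with h0 | h0
  · rw [← h0]
    simp
  obtain ⟨k', hk'⟩ := h.sub_ae_eq_const hℓ j hb hG hx h0
  -- Both constants are the value of `b - G` almost everywhere on `(0, min x y]`, a set of positive
  -- measure.
  have hkk : k = k' := by
    by_contra hne
    have hnull : volume (Ioc 0 (min x y)) = 0 := by
      rw [← nonpos_iff_eq_zero]
      refine (measure_mono_null ?_ (hk.and hk')).le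
      intro t ht hcon
      exact hne ((hcon.1 ⟨ht.1, ht.2.trans (min_le_right _ _)⟩).symm.trans
        (hcon.2 ⟨ht.1, ht.2.trans (min_le_left _ _)⟩))
    rw [Real.volume_Ioc, ENNReal.ofReal_eq_zero] at hnull
    have := lt_min h0 hy0
    linarith
  filter_upwards [hk'] with t ht htx
  have := ht (Ioo_subset_Ioc_self htx)
  simp only [hGdef, zero_add] at this
  rw [hkk]
  linear_combination this

end Regularity

/-! ### An affine cutoff function -/

section Cutoff

/-- The cutoff function equal to `1` on `[0, a]` and to `0` on `[2a, ∞)`, and affine in between. -/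
def cutoff (a x : ℝ) : ℝ := 1 - a⁻¹ * max 0 (min x (2 * a) - a)

/-- The derivative of `cutoff`. -/
def cutoffDeriv (a : ℝ) : ℝ → ℝ := (Ioc a (2 * a)).indicator fun _ => -a⁻¹

variable {a : ℝ}

theorem cutoff_of_le {x : ℝ} (h : x ≤ a) : cutoff a x = 1 := by
  have : min x (2 * a) - a ≤ 0 := by linarith [min_le_left x (2 * a)]
  rw [cutoff, max_eq_left this, mul_zero, sub_zero]

theorem cutoff_of_ge (ha : 0 < a) {x : ℝ} (h : 2 * a ≤ x) : cutoff a x = 0 := by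
  rw [cutoff, min_eq_right h, max_eq_right (by linarith)]
  field_simp
  ring

theorem cutoffDeriv_of_gt {x : ℝ} (h : 2 * a < x) : cutoffDeriv a x = 0 :=
  indicator_of_notMem (fun hx => absurd hx.2 (not_le.2 h)) _

theorem abs_cutoffDeriv_le (ha : 0 < a) (x : ℝ) : |cutoffDeriv a x| ≤ a⁻¹ := by
  unfold cutoffDeriv
  by_cases h : x ∈ Ioc a (2 * a)
  · rw [indicator_of_mem h, abs_neg, abs_of_pos (inv_pos.2 ha)]
  · rw [indicator_of_notMem h, abs_zero]
    exact (inv_pos.2 ha).le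

theorem measurable_cutoffDeriv (a : ℝ) : Measurable (cutoffDeriv a) :=
  measurable_const.indicator measurableSet_Ioc

theorem hasLocACDeriv_cutoff (ha : 0 < a) (ℓ : EReal) :
    HasLocACDeriv ℓ (fun x => (cutoff a x : ℂ)) (fun x => (cutoffDeriv a x : ℂ)) := by
  intro x hx
  have e : (fun t => (cutoffDeriv a t : ℂ)) = (Ioc a (2 * a)).indicator fun _ => -(a : ℂ)⁻¹ := by
    funext t
    unfold cutoffDeriv
    by_cases h : t ∈ Ioc a (2 * a)
    · simp [indicator_of_mem h]
    · simp [indicator_of_notMem h]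
  have hi : Integrable (fun t => (cutoffDeriv a t : ℂ)) volume := by
    rw [e, integrable_indicator_iff measurableSet_Ioc]
    exact integrableOn_const measure_Ioc_lt_top.ne
  refine ⟨hi.intervalIntegrable, ?_⟩
  simp only [cutoff_of_le ha.le]
  rw [intervalIntegral.integral_of_le hx.1, e, setIntegral_indicator measurableSet_Ioc,
    setIntegral_const, Ioc_inter_Ioc, Measure.real, Real.volume_Ioc,
    ENNReal.toReal_ofReal', max_eq_right ha.le, cutoff, max_comm]
  simp only [Complex.real_smul]
  push_cast
  ring

end Cutoff

/-! ### Vertex and end conditions for weak solutions -/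

section StrongSolution

variable {N : ℕ} {ℓ : Fin N → EReal} {ω : Fin N → ℝ} {α : ℝ} {F b r D : Fin N → ℝ → ℂ} {c : ℂ}

theorem exists_pos_mem_link {ℓ : EReal} (hℓ : 0 < ℓ) : ∃ y : ℝ, y ∈ link ℓ := by
  obtain ⟨q, hq1, hq2⟩ := EReal.lt_iff_exists_rat_btwn.1 hℓ
  exact ⟨q, by exact_mod_cast hq1, hq2⟩

theorem integral_conj_mul_of_ae_eq {ℓ : EReal} {b r D f f' : ℝ → ℂ} (hD : HasLocACDeriv ℓ D r)
    (hbD : b =ᵐ[linkMeasure ℓ] D) (hf : HasLocACDeriv ℓ f f') {x : ℝ} (hx : x ∈ closedLink ℓ) :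
    ∫ t in (0 : ℝ)..x, (starRingEnd ℂ (b t) * f' t + starRingEnd ℂ (r t) * f t) =
      starRingEnd ℂ (D x) * f x - starRingEnd ℂ (D 0) * f 0 := by
  rw [← (hD.integral_conj_mul hf hx).2, intervalIntegral_eq_setIntegral_linkMeasure hx,
    intervalIntegral_eq_setIntegral_linkMeasure hx]
  refine integral_congr_ae (ae_restrict_of_ae ?_)
  filter_upwards [hbD] with t ht
  rw [ht]

theorem memLp_cutoffDeriv (a : ℝ) (ℓ : EReal) :
    MemLp (fun t => (cutoffDeriv a t : ℂ)) 2 (linkMeasure ℓ) := by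
  have h : MemLp (cutoffDeriv a) 2 (linkMeasure ℓ) :=
    memLp_indicator_const 2 measurableSet_Ioc _ (Or.inr (linkMeasure_Ioc_ne_top ℓ a (2 * a)))
  exact h.ofReal

/-- A weak solution satisfies the coupling condition at the vertex. -/
theorem IsWeakSolution.vertex_condition (h : IsWeakSolution ℓ ω α F b r c) (hℓ : ∀ j, 0 < ℓ j)
    (hD : ∀ j, HasLocACDeriv (ℓ j) (D j) (r j)) (hbD : ∀ j, b j =ᵐ[linkMeasure (ℓ j)] D j) :
    ∑ j, D j 0 = (α : ℂ) * c := by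
  choose y hy using fun j => exists_pos_mem_link (hℓ j)
  have ha : ∀ j, 0 < y j / 2 := fun j => half_pos (hy j).1
  have h2 : ∀ j, 2 * (y j / 2) = y j := fun j => by ring
  have hlast : ∀ j, ∀ e : ℝ, ℓ j = e → cutoff (y j / 2) e = 0 := fun j e he => by
    refine cutoff_of_ge (ha j) ?_
    rw [h2]
    have := (hy j).2
    rw [he] at this
    exact_mod_cast this.le
  -- The test function equals `1` at the vertex and vanishes from the interior point `y j` on, so
  -- integration by parts leaves only the vertex terms.
  have key := h (fun j t => (cutoff (y j / 2) t : ℂ)) (fun j t => (cutoffDeriv (y j / 2) t : ℂ)) 1 y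
    (fun j => link_subset_closedLink (hy j)) (fun j => hasLocACDeriv_cutoff (ha j) _)
    (fun j => by simp [cutoff_of_le (ha j).le])
    (fun j t _ htx => ⟨by simp [cutoff_of_ge (ha j) (h2 j ▸ htx.le)],
      by simp [cutoffDeriv_of_gt (a := y j / 2) (x := t) (by rw [h2]; exact htx)]⟩)
    (fun j => memLp_cutoffDeriv _ _) (fun j e he _ => by simp [hlast j e he])
  have hj : ∀ j, (∫ t in (0 : ℝ)..(y j), (starRingEnd ℂ (b j t) * (cutoffDeriv (y j / 2) t : ℂ) +
      starRingEnd ℂ (r j t) * (cutoff (y j / 2) t : ℂ))) + (endCoeff (ℓ j) (ω j) : ℂ) *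
        (starRingEnd ℂ (F j (ℓ j).toReal) * (cutoff (y j / 2) (ℓ j).toReal : ℂ)) =
      - starRingEnd ℂ (D j 0) := by
    intro j
    rw [integral_conj_mul_of_ae_eq (hD j) (hbD j) (hasLocACDeriv_cutoff (ha j) _)
      (link_subset_closedLink (hy j)), cutoff_of_ge (ha j) (h2 j).le, cutoff_of_le (ha j).le]
    have hend : (endCoeff (ℓ j) (ω j) : ℂ) *
        (starRingEnd ℂ (F j (ℓ j).toReal) * (cutoff (y j / 2) (ℓ j).toReal : ℂ)) = 0 := by
      rcases eq_or_ne (ℓ j) ⊤ with ht | ht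
      · simp [endCoeff, ht]
      · rw [hlast j _ (EReal.coe_toReal ht (hℓ j).ne_bot).symm]
        simp
    rw [hend]
    simp
  simp only [hj, Finset.sum_neg_distrib, mul_one] at key
  have := congrArg (starRingEnd ℂ) key
  simp only [map_add, map_mul, map_neg, map_sum, Complex.conj_conj, Complex.conj_ofReal,
    map_zero] at this
  linear_combination -this

/-- A weak solution satisfies the boundary conditions at the ends of the links. -/
theorem IsWeakSolution.end_condition (h : IsWeakSolution ℓ ω α F b r c) (hℓ : ∀ j, 0 < ℓ j)
    {j : Fin N} (hD : HasLocACDeriv (ℓ j) (D j) (r j)) (hbD : b j =ᵐ[linkMeasure (ℓ j)] D j)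
    {e : ℝ} (he : ℓ j = e) (hF : Real.sin (ω j) = 0 → F j e = 0) :
    F j e * (Real.cos (ω j) : ℂ) + D j e * (Real.sin (ω j) : ℂ) = 0 := by
  by_cases hs : Real.sin (ω j) = 0
  · rw [hF hs, hs]
    simp
  have he0 : 0 < e := by
    have := hℓ j
    rw [he] at this
    exact_mod_cast this
  have hx : e ∈ closedLink (ℓ j) := ⟨he0.le, he.ge⟩
  -- The test function `t` vanishes at the vertex and has the nonzero value `e` at the end, which
  -- isolates the Robin condition.
  have hid : HasLocACDeriv (ℓ j) (fun t => (t : ℂ)) (fun _ => 1) :=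
    hasLocACDeriv_of_hasDerivAt (fun t => Complex.ofRealCLM.hasDerivAt) continuous_const
  have hlink : link (ℓ j) ⊆ Ioc 0 e := fun t ht => by
    have h2 := ht.2
    rw [he] at h2
    exact ⟨ht.1, le_of_lt (by exact_mod_cast h2)⟩
  have hfin : IsFiniteMeasure (linkMeasure (ℓ j)) :=
    ⟨by
      rw [Measure.restrict_apply_univ]
      exact (measure_mono hlink).trans_lt measure_Ioc_lt_top⟩
  have key := h.single hℓ j hx hid (by simp)
    (fun t ht hxt => absurd (hlink ht).2 (not_le.2 hxt)) (memLp_const 1)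
    (fun e' _ hs' => absurd hs' hs)
  rw [integral_conj_mul_of_ae_eq hD hbD hid hx, he, EReal.toReal_coe, endCoeff,
    if_neg (EReal.coe_ne_top e)] at key
  have hsC : (Real.sin (ω j) : ℂ) ≠ 0 := by exact_mod_cast hs
  have heC : (e : ℂ) ≠ 0 := by exact_mod_cast he0.ne'
  have k2 := congrArg (starRingEnd ℂ) key
  simp only [map_add, map_mul, map_div₀, Complex.conj_conj, Complex.conj_ofReal, map_zero,
    Complex.ofReal_zero, mul_zero, sub_zero, Complex.ofReal_div] at k2
  have k3 : (e : ℂ) * (F j e * (Real.cos (ω j) : ℂ) + D j e * (Real.sin (ω j) : ℂ)) = 0 := by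
    have hq := div_mul_cancel₀ (Real.cos (ω j) : ℂ) hsC
    linear_combination (Real.sin (ω j) : ℂ) * k2 - (e : ℂ) * F j e * hq
  exact (mul_eq_zero.1 k3).resolve_left heC

end StrongSolution

/-! ### From the form equation to the Hamiltonian -/

section WeakEquation

open scoped InnerProductSpace

variable {N : ℕ} {ℓ : Fin N → EReal} {ω : Fin N → ℝ} {V : Fin N → ℝ → ℝ} {m s κ : ℝ}

/-- Test functions with bounded support on each link have finite energy, hence define elements of
the form domain. Their support turns the integrals over the links into interval integrals. -/
theorem isWeakSolution_of_inner (hℓ : ∀ j, 0 < ℓ j)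
    (hV : ∀ j, LocallyIntegrableOn (V j) (closedLink (ℓ j)) volume)
    (hm : ∀ j, ∀ᵐ x ∂linkMeasure (ℓ j), m ≤ V j x)
    (hκ : TraceBound ℓ ω (formWeight V m) s κ) (hs : s ≠ 0) {α : ℝ} {U : Fin N → ℝ → ℝ}
    (hU : ∀ j, Integrable (U j) (linkMeasure (ℓ j)))
    {p : formDomain ℓ ω (formWeight V m) s} {g : StateSpace ℓ}
    (hw : ∀ q : formDomain ℓ ω (formWeight V m) s, ⟪p, q⟫_ℂ +
      pertForm α U (fun j => endCoeff (ℓ j) (ω j)) (p : FormSpace ℓ) q =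
        ⟪g, formInclusion ℓ ω (formWeight V m) s q⟫_ℂ) :
    IsWeakSolution ℓ ω α (fun j x => evalAt j x (p : FormSpace ℓ))
      (fun j => component 0 j (p : FormSpace ℓ))
      (fun j x => ((V j x + U j x - m + s ^ 2 : ℝ) : ℂ) * evalAt j x (p : FormSpace ℓ) - g j x)
      (vertex (p : FormSpace ℓ)) := by
  intro f f' c' x hx hf hc hv hf' hD
  obtain ⟨q, hq1, hq2, hq3⟩ := exists_mem_formDomain (w := formWeight V m) (s := s) (ω := ω)
    hℓ hf hc hf'
    (fun j => (hf j).memLp_weight_mul_of_vanish (hx j) (fun t ht hxt => (hv j t ht hxt).1) (hV j) m)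
    (fun j => (hf j).memLp_of_vanish (hx j) (fun t ht hxt => (hv j t ht hxt).1)) hD
  obtain ⟨e1, e2⟩ := inner_add_pertForm hm hκ α hU (fun j => endCoeff (ℓ j) (ω j)) p q
  have hwq := hw q
  have hg : ⟪g, formInclusion ℓ ω (formWeight V m) s q⟫_ℂ =
      ∑ j, ∫ t, starRingEnd ℂ (g j t) * formInclusion ℓ ω (formWeight V m) s q j t
        ∂linkMeasure (ℓ j) := by
    rw [PiLp.inner_apply]
    refine Finset.sum_congr rfl fun j _ => ?_
    rw [L2.inner_def]
    simp only [RCLike.inner_apply, mul_comm]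
  rw [e1, hg, ← sub_eq_zero, add_sub_assoc, ← Finset.sum_sub_distrib, hq1] at hwq
  rw [← hwq]
  congr 1
  refine Finset.sum_congr rfl fun j _ => ?_
  rw [add_sub_right_comm, ← integral_sub (e2 j) (integrable_conj_mul_Lp _ _),
    hq3 j _ (toReal_mem_closedLink (hℓ j))]
  congr 1
  rw [← integral_linkMeasure_eq (hx j) (fun t ht hxt => by
    rw [(hv j t ht hxt).1, (hv j t ht hxt).2, mul_zero, mul_zero, add_zero])]
  refine integral_congr_ae ?_
  filter_upwards [hq2 j, formInclusion_ae_eq hs q j,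
    ae_restrict_mem (measurableSet_link (ℓ j))] with t h1 h2 h3
  rw [h1, h2, hq3 j t (link_subset_closedLink h3)]
  simp only [map_sub, map_mul, Complex.conj_ofReal]
  ring

/-- A solution of the weak equation is in the domain of the Hamiltonian. -/
theorem mem_hamiltonianGraph_of_inner (hℓ : ∀ j, 0 < ℓ j)
    (hV : ∀ j, LocallyIntegrableOn (V j) (closedLink (ℓ j)) volume)
    (hm : ∀ j, ∀ᵐ x ∂linkMeasure (ℓ j), m ≤ V j x)
    (hκ : TraceBound ℓ ω (formWeight V m) s κ) (hs : s ≠ 0) {α : ℝ} {U : Fin N → ℝ → ℝ}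
    (hU : ∀ j, Integrable (U j) (linkMeasure (ℓ j)))
    {p : formDomain ℓ ω (formWeight V m) s} {g : StateSpace ℓ}
    (hw : ∀ q : formDomain ℓ ω (formWeight V m) s, ⟪p, q⟫_ℂ +
      pertForm α U (fun j => endCoeff (ℓ j) (ω j)) (p : FormSpace ℓ) q =
        ⟪g, formInclusion ℓ ω (formWeight V m) s q⟫_ℂ) :
    (formInclusion ℓ ω (formWeight V m) s p,
      g + ((m - s ^ 2 : ℝ) : ℂ) • formInclusion ℓ ω (formWeight V m) s p) ∈
      hamiltonianGraph ℓ ω α (fun j => V j + U j) := by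
  have hws := isWeakSolution_of_inner hℓ hV hm hκ hs hU hw
  have hFac := fun j => hasLocACDeriv_evalAt j (p : FormSpace ℓ)
  have hr : ∀ j, ∀ x ∈ closedLink (ℓ j), IntervalIntegrable (fun x =>
      ((V j x + U j x - m + s ^ 2 : ℝ) : ℂ) * evalAt j x (p : FormSpace ℓ) - g j x) volume 0 x := by
    intro j x hx
    have h1 : IntervalIntegrable (fun x => V j x + U j x - m + s ^ 2) volume 0 x :=
      (((intervalIntegrable_of_locallyIntegrableOn (hV j) hx).add
        (intervalIntegrable_of_integrable_linkMeasure (hU j) hx)).sub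
        intervalIntegrable_const).add intervalIntegrable_const
    have h2 : IntervalIntegrable (fun x => ((V j x + U j x - m + s ^ 2 : ℝ) : ℂ)) volume 0 x :=
      ⟨h1.1.ofReal, h1.2.ofReal⟩
    exact ((hFac j).intervalIntegrable_mul hx h2).sub
      ((intervalIntegrable_iff_integrableOn_linkMeasure hx).2 (integrableOn_Ioc_of_Lp _ _ _))
  choose D hD hbD using fun j => hws.exists_deriv hℓ j (Lp.memLp _) (hr j)
  refine ⟨fun j x => evalAt j x (p : FormSpace ℓ), D, fun j x =>
      ((V j x + U j x - m + s ^ 2 : ℝ) : ℂ) * evalAt j x (p : FormSpace ℓ) - g j x,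
    fun j => formInclusion_ae_eq hs p j, fun j => (hFac j).congr_ae (hbD j), hD, fun j => ?_,
    ⟨vertex (p : FormSpace ℓ), fun j => evalAt_zero j _, hws.vertex_condition hℓ hD hbD⟩,
    fun j e he => hws.end_condition hℓ (hD j) (hbD j) he fun hs0 => (p.2 j).2.2 e he hs0⟩
  have e : (g + ((m - s ^ 2 : ℝ) : ℂ) • formInclusion ℓ ω (formWeight V m) s p) j =
    g j + ((m - s ^ 2 : ℝ) : ℂ) • (formInclusion ℓ ω (formWeight V m) s p j) := rfl
  simp only [e]
  filter_upwards [Lp.coeFn_add (g j)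
    (((m - s ^ 2 : ℝ) : ℂ) • (formInclusion ℓ ω (formWeight V m) s p j)),
    Lp.coeFn_smul ((m - s ^ 2 : ℝ) : ℂ) (formInclusion ℓ ω (formWeight V m) s p j),
    formInclusion_ae_eq hs p j] with t h1 h2 h3
  rw [h1, Pi.add_apply, h2, Pi.smul_apply, h3]
  simp only [Pi.add_apply, smul_eq_mul]
  push_cast
  ring

end WeakEquation

/-! ### The localization formula -/

section Localization

/-- The localization formula on one link: the energy of `χ f`, for a solution `f` of `f'' = X f`
and a cutoff function `χ`. -/
theorem integral_energy_cutoff {ℓ : EReal} {f f' f'' : ℝ → ℂ} {X : ℝ → ℝ} {a x : ℝ} (ha : 0 < a)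
    (hf : HasLocACDeriv ℓ f f') (hf' : HasLocACDeriv ℓ f' f'')
    (hX : f'' =ᵐ[linkMeasure ℓ] fun t => (X t : ℂ) * f t) (hx : x ∈ closedLink ℓ)
    (hi : IntervalIntegrable (fun t =>
      starRingEnd ℂ ((cutoffDeriv a t : ℂ) * f t + (cutoff a t : ℂ) * f' t) *
        ((cutoffDeriv a t : ℂ) * f t + (cutoff a t : ℂ) * f' t) + (X t : ℂ) *
        (starRingEnd ℂ ((cutoff a t : ℂ) * f t) * ((cutoff a t : ℂ) * f t))) volume 0 x) :
    (∫ t in (0 : ℝ)..x,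
      (starRingEnd ℂ ((cutoffDeriv a t : ℂ) * f t + (cutoff a t : ℂ) * f' t) *
        ((cutoffDeriv a t : ℂ) * f t + (cutoff a t : ℂ) * f' t) + (X t : ℂ) *
        (starRingEnd ℂ ((cutoff a t : ℂ) * f t) * ((cutoff a t : ℂ) * f t)))).re =
      (∫ t in (0 : ℝ)..x, cutoffDeriv a t ^ 2 * ‖f t‖ ^ 2) +
        (starRingEnd ℂ (f' x) * ((cutoff a x : ℂ) * ((cutoff a x : ℂ) * f x)) -
          starRingEnd ℂ (f' 0) * f 0).re := by
  have hχ := hasLocACDeriv_cutoff ha ℓ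
  -- Integration by parts of `f'` against `χ² f`. Pointwise, `|(χf)'|² = χ'²|f|² + Re (conj f' ·
  -- (χ²f)')`.
  obtain ⟨hi2, e2⟩ := hf'.integral_conj_mul (hχ.mul (hχ.mul hf)) hx
  simp only [cutoff_of_le ha.le, Complex.ofReal_one, one_mul] at e2
  rw [← e2]
  have hc : IntervalIntegrable (fun t => cutoffDeriv a t ^ 2 * ‖f t‖ ^ 2) volume 0 x := by
    have h1 : IntervalIntegrable (fun t => cutoffDeriv a t ^ 2) volume 0 x := by
      rw [intervalIntegrable_iff_integrableOn_Ioc_of_le hx.1]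
      refine Measure.integrableOn_of_bounded (M := (a⁻¹) ^ 2) measure_Ioc_lt_top.ne
        ((measurable_cutoffDeriv a).pow_const 2).aestronglyMeasurable
        (Eventually.of_forall fun t => ?_)
      rw [Real.norm_eq_abs, abs_pow]
      exact pow_le_pow_left₀ (abs_nonneg _) (abs_cutoffDeriv_le ha t) 2
    refine h1.mul_continuousOn ?_
    rw [uIcc_of_le hx.1]
    exact (hf.continuousOn_Icc hx).norm.pow 2
  have re_comm : ∀ {k : ℝ → ℂ}, IntervalIntegrable k volume 0 x →
      (∫ t in (0 : ℝ)..x, k t).re = ∫ t in (0 : ℝ)..x, (k t).re := fun hk =>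
    (Complex.reCLM.intervalIntegral_comp_comm hk).symm
  have hi3 : IntervalIntegrable (fun t => (starRingEnd ℂ (f' t) *
      ((cutoffDeriv a t : ℂ) * ((cutoff a t : ℂ) * f t) + (cutoff a t : ℂ) *
        ((cutoffDeriv a t : ℂ) * f t + (cutoff a t : ℂ) * f' t)) +
      starRingEnd ℂ (f'' t) * ((cutoff a t : ℂ) * ((cutoff a t : ℂ) * f t))).re) volume 0 x :=
    ⟨hi2.1.re, hi2.2.re⟩
  rw [re_comm hi, re_comm hi2, ← intervalIntegral.integral_add hc hi3,
    intervalIntegral.integral_of_le hx.1, intervalIntegral.integral_of_le hx.1,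
    ← restrict_linkMeasure_Ioc hx]
  refine integral_congr_ae (ae_restrict_of_ae ?_)
  filter_upwards [hX] with t ht
  rw [ht]
  simp only [← Complex.normSq_eq_norm_sq, Complex.normSq_apply, map_add, map_mul,
    Complex.conj_ofReal, Complex.add_re, Complex.mul_re, Complex.mul_im, Complex.add_im,
    Complex.conj_re, Complex.conj_im, Complex.ofReal_re, Complex.ofReal_im]
  ring

end Localization

/-! ### Injectivity and the resolvent of the Hamiltonian -/

section Injectivity

open scoped InnerProductSpace

variable {N : ℕ} {ℓ : Fin N → EReal} {ω : Fin N → ℝ} {V : Fin N → ℝ → ℝ} {m s κ : ℝ}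

/-- Coercivity of the energy form, with a positive constant as soon as `T` is a strict contraction.
-/
theorem one_sub_norm_mul_sq_le {Q : Type*} [NormedAddCommGroup Q] [InnerProductSpace ℂ Q]
    (T : Q →L[ℂ] Q) (q : Q) : (1 - ‖T‖) * ‖q‖ ^ 2 ≤ (⟪q, q⟫_ℂ + ⟪T q, q⟫_ℂ).re := by
  have h1 : ‖⟪T q, q⟫_ℂ‖ ≤ ‖T‖ * ‖q‖ ^ 2 := by
    refine (norm_inner_le_norm _ _).trans ?_
    rw [sq, ← mul_assoc]
    exact mul_le_mul_of_nonneg_right (T.le_opNorm q) (norm_nonneg _)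
  have h2 := (abs_le.1 (Complex.abs_re_le_norm (⟪T q, q⟫_ℂ))).1
  have h3 : (⟪q, q⟫_ℂ).re = ‖q‖ ^ 2 := inner_self_eq_norm_sq (𝕜 := ℂ) q
  rw [Complex.add_re, h3]
  linarith

/-- At the end of a link, the boundary term of the energy cancels the one from partial
integration. -/
theorem end_term_cancel {ℓ : EReal} {ω : ℝ} {f f' : ℝ → ℂ} {e : ℝ} (he : ℓ = e)
    (h : f e * (Real.cos ω : ℂ) + f' e * (Real.sin ω : ℂ) = 0) :
    starRingEnd ℂ (f' e) * f e + (endCoeff ℓ ω : ℂ) * (starRingEnd ℂ (f e) * f e) = 0 := by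
  by_cases hs : Real.sin ω = 0
  · have hc : (Real.cos ω : ℂ) ≠ 0 := by
      have := Real.sin_sq_add_cos_sq ω
      rw [hs] at this
      intro h0
      have h0' : Real.cos ω = 0 := by exact_mod_cast h0
      rw [h0'] at this
      norm_num at this
    rw [hs, Complex.ofReal_zero, mul_zero, add_zero] at h
    rw [(mul_eq_zero.1 h).resolve_right hc]
    simp
  · have hsC : (Real.sin ω : ℂ) ≠ 0 := by exact_mod_cast hs
    rw [endCoeff, he, if_neg (EReal.coe_ne_top e)]
    have h2 := congrArg (starRingEnd ℂ) h
    simp only [map_add, map_mul, Complex.conj_ofReal, map_zero] at h2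
    rw [Complex.ofReal_div]
    field_simp
    linear_combination f e * h2

/-- The Hamiltonian has no eigenvalue below the energy form. -/
theorem eq_zero_of_mem_hamiltonianGraph (hℓ : ∀ j, 0 < ℓ j)
    (hV : ∀ j, LocallyIntegrableOn (V j) (closedLink (ℓ j)) volume)
    (hm : ∀ j, ∀ᵐ x ∂linkMeasure (ℓ j), m ≤ V j x)
    (hκ : TraceBound ℓ ω (formWeight V m) s κ) {α : ℝ} {U : Fin N → ℝ → ℝ}
    (hU : ∀ j, Integrable (U j) (linkMeasure (ℓ j)))
    {T : formDomain ℓ ω (formWeight V m) s →L[ℂ] formDomain ℓ ω (formWeight V m) s}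
    (hT1 : ‖T‖ < 1) (hT : ∀ p q, ⟪T p, q⟫_ℂ =
      pertForm α U (fun j => endCoeff (ℓ j) (ω j)) (p : FormSpace ℓ) q)
    {ψ : StateSpace ℓ} (hψ : (ψ, ((m - s ^ 2 : ℝ) : ℂ) • ψ) ∈
      hamiltonianGraph ℓ ω α (fun j => V j + U j)) : ψ = 0 := by
  obtain ⟨f, f', f'', h1, h2, h3, h4, ⟨c, h5, h6⟩, h7⟩ := hψ
  simp only at h1 h4
  set X : Fin N → ℝ → ℝ := fun j t => V j t + U j t - m + s ^ 2 with hXdef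
  have hX : ∀ j, f'' j =ᵐ[linkMeasure (ℓ j)] fun t => (X j t : ℂ) * f j t := by
    intro j
    have e : (((m - s ^ 2 : ℝ) : ℂ) • ψ) j = ((m - s ^ 2 : ℝ) : ℂ) • ψ j := rfl
    have h4j := h4 j
    rw [e] at h4j
    filter_upwards [h1 j, h4j, Lp.coeFn_smul ((m - s ^ 2 : ℝ) : ℂ) (ψ j)] with t a1 a2 a3
    rw [a3, Pi.smul_apply, a1, smul_eq_mul] at a2
    simp only [Pi.add_apply] at a2
    simp only [hXdef]
    push_cast at a2 ⊢
    linear_combination a2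
  have hfL : ∀ j, MemLp (f j) 2 (linkMeasure (ℓ j)) := fun j =>
    (memLp_congr_ae (h1 j)).1 (Lp.memLp _)
  set S : ℝ := ∑ j, ∫ t, ‖f j t‖ ^ 2 ∂linkMeasure (ℓ j) with hS
  -- The energy of `f` itself need not be finite, but that of `χ f` is, and it equals `∑ⱼ ∫ χ'²|fⱼ|²
  -- ≤ S a⁻²`. Coercivity and the trace bound turn this into a pointwise bound on `f` where `χ = 1`.
  have main : ∀ a : ℝ, 0 < a → (∀ j, (ℓ j).toReal ≤ a) → ∀ j, ∀ x ∈ closedLink (ℓ j), x ≤ a →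
      (1 - ‖T‖) * ‖f j x‖ ^ 2 ≤ κ ^ 2 * S * (a⁻¹) ^ 2 := by
    intro a ha hla
    -- Infinite links are cut off at `2a`; finite links have length at most `a`, so `χ = 1` on them
    -- and their end conditions are untouched.
    set x : Fin N → ℝ := fun j => if ℓ j = ⊤ then 2 * a else (ℓ j).toReal with hxdef
    have hx : ∀ j, x j ∈ closedLink (ℓ j) := by
      intro j
      simp only [hxdef]
      split_ifs with ht
      · exact ⟨by positivity, by rw [ht]; exact le_top⟩
      · exact toReal_mem_closedLink (hℓ j)
    have hv : ∀ j, ∀ t ∈ link (ℓ j), x j < t → cutoff a t = 0 ∧ cutoffDeriv a t = 0 := by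
      intro j t ht hxt
      simp only [hxdef] at hxt
      split_ifs at hxt with htop
      · exact ⟨cutoff_of_ge ha hxt.le, cutoffDeriv_of_gt hxt⟩
      · have h' := ht.2
        rw [← EReal.coe_toReal htop (hℓ j).ne_bot] at h'
        exact absurd hxt (not_lt.2 (le_of_lt (by exact_mod_cast h')))
    have hχ := fun j => hasLocACDeriv_cutoff ha (ℓ j)
    have hq := fun j => (hχ j).mul (h2 j)
    have hder : ∀ j, MemLp (fun t => (cutoffDeriv a t : ℂ) * f j t + (cutoff a t : ℂ) * f' j t) 2
        (linkMeasure (ℓ j)) := by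
      intro j
      -- `χ' f` is a bounded function times an `L²` function; `χ f'` is continuous on `[0, x j]` and
      -- vanishes beyond.
      refine MemLp.add (f := fun t => (cutoffDeriv a t : ℂ) * f j t) ?_
        (((hχ j).mul (h3 j)).memLp_of_vanish (hx j) fun t ht hxt => by simp [(hv j t ht hxt).1])
      refine (hfL j).of_le_mul (c := a⁻¹) ((Complex.measurable_ofReal.comp
        (measurable_cutoffDeriv a)).aestronglyMeasurable.mul (h2 j).aestronglyMeasurable)
        (Eventually.of_forall fun t => ?_)
      rw [norm_mul, Complex.norm_real, Real.norm_eq_abs]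
      exact mul_le_mul_of_nonneg_right (abs_cutoffDeriv_le ha t) (norm_nonneg _)
    obtain ⟨q, hq1, hq2, hq3⟩ := exists_mem_formDomain (w := formWeight V m) (s := s) (ω := ω)
      hℓ hq (c := c) (fun j => by simp [cutoff_of_le ha.le, h5 j]) hder
      (fun j => (hq j).memLp_weight_mul_of_vanish (hx j)
        (fun t ht hxt => by simp [(hv j t ht hxt).1]) (hV j) m)
      (fun j => (hq j).memLp_of_vanish (hx j) (fun t ht hxt => by simp [(hv j t ht hxt).1]))
      (fun j e he hs0 => by
        have h7' := h7 j e he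
        rw [hs0, Complex.ofReal_zero, mul_zero, add_zero] at h7'
        have hc : (Real.cos (ω j) : ℂ) ≠ 0 := by
          have := Real.sin_sq_add_cos_sq (ω j)
          rw [hs0] at this
          intro h0
          have h0' : Real.cos (ω j) = 0 := by exact_mod_cast h0
          rw [h0'] at this
          norm_num at this
        rw [(mul_eq_zero.1 h7').resolve_right hc, mul_zero])
    obtain ⟨e1, e2⟩ := inner_add_pertForm hm hκ α hU (fun j => endCoeff (ℓ j) (ω j)) q q
    have hE : ∀ j, (fun t => starRingEnd ℂ (component 0 j (q : FormSpace ℓ) t) *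
          component 0 j (q : FormSpace ℓ) t + ((V j t + U j t - m + s ^ 2 : ℝ) : ℂ) *
        (starRingEnd ℂ (evalAt j t (q : FormSpace ℓ)) * evalAt j t (q : FormSpace ℓ)))
        =ᵐ[linkMeasure (ℓ j)] fun t =>
      starRingEnd ℂ ((cutoffDeriv a t : ℂ) * f j t + (cutoff a t : ℂ) * f' j t) *
        ((cutoffDeriv a t : ℂ) * f j t + (cutoff a t : ℂ) * f' j t) + (X j t : ℂ) *
        (starRingEnd ℂ ((cutoff a t : ℂ) * f j t) * ((cutoff a t : ℂ) * f j t)) := by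
      intro j
      filter_upwards [hq2 j, ae_restrict_mem (measurableSet_link (ℓ j))] with t a1 a2
      rw [a1, hq3 j t (link_subset_closedLink a2)]
    have hen : ∀ j, ((∫ t, (starRingEnd ℂ (component 0 j (q : FormSpace ℓ) t) *
          component 0 j (q : FormSpace ℓ) t + ((V j t + U j t - m + s ^ 2 : ℝ) : ℂ) *
        (starRingEnd ℂ (evalAt j t (q : FormSpace ℓ)) * evalAt j t (q : FormSpace ℓ)))
          ∂linkMeasure (ℓ j)) + (endCoeff (ℓ j) (ω j) : ℂ) *
          (starRingEnd ℂ (evalAt j (ℓ j).toReal (q : FormSpace ℓ)) *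
            evalAt j (ℓ j).toReal (q : FormSpace ℓ))).re =
        (∫ t in (0 : ℝ)..(x j), cutoffDeriv a t ^ 2 * ‖f j t‖ ^ 2) -
          (starRingEnd ℂ (f' j 0) * c).re := by
      intro j
      have hint := (e2 j).congr (hE j)
      rw [integral_congr_ae (hE j), integral_linkMeasure_eq (hx j)
        (fun t ht hxt => by simp [(hv j t ht hxt).1, (hv j t ht hxt).2]), Complex.add_re,
        integral_energy_cutoff ha (h2 j) (h3 j) (hX j) (hx j)
          (intervalIntegrable_of_integrable_linkMeasure hint (hx j)),
        hq3 j _ (toReal_mem_closedLink (hℓ j)), h5 j, Complex.sub_re]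
      have hend : (starRingEnd ℂ (f' j (x j)) * ((cutoff a (x j) : ℂ) *
          ((cutoff a (x j) : ℂ) * f j (x j)))).re + ((endCoeff (ℓ j) (ω j) : ℂ) *
          (starRingEnd ℂ ((cutoff a (ℓ j).toReal : ℂ) * f j (ℓ j).toReal) *
            ((cutoff a (ℓ j).toReal : ℂ) * f j (ℓ j).toReal))).re = 0 := by
        by_cases ht : ℓ j = ⊤
        · have hxj : x j = 2 * a := by simp [hxdef, ht]
          rw [hxj, cutoff_of_ge ha le_rfl]
          simp [endCoeff, ht]
        · have hxj : x j = (ℓ j).toReal := by simp [hxdef, ht]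
          have he : ℓ j = ((ℓ j).toReal : EReal) := (EReal.coe_toReal ht (hℓ j).ne_bot).symm
          rw [hxj, cutoff_of_le (hla j), Complex.ofReal_one, one_mul, one_mul, ← Complex.add_re,
            end_term_cancel he (h7 j _ he), Complex.zero_re]
      linarith
    -- The coupling condition makes `α |c|²` cancel the vertex terms of the integrations by parts.
    have hsum : (⟪q, q⟫_ℂ + ⟪T q, q⟫_ℂ).re =
        ∑ j, ∫ t in (0 : ℝ)..(x j), cutoffDeriv a t ^ 2 * ‖f j t‖ ^ 2 := by
      rw [hT, e1, Complex.add_re, Complex.re_sum, Finset.sum_congr rfl fun j _ => hen j,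
        Finset.sum_sub_distrib, ← Complex.re_sum, ← Finset.sum_mul, ← map_sum, h6, hq1,
        map_mul, Complex.conj_ofReal, mul_assoc]
      ring
    have hbound : ∑ j, ∫ t in (0 : ℝ)..(x j), cutoffDeriv a t ^ 2 * ‖f j t‖ ^ 2 ≤
        S * (a⁻¹) ^ 2 := by
      rw [hS, Finset.sum_mul]
      refine Finset.sum_le_sum fun j _ => ?_
      have hfi : Integrable (fun t => ‖f j t‖ ^ 2) (linkMeasure (ℓ j)) :=
        (hfL j).integrable_norm_pow two_ne_zero
      rw [intervalIntegral.integral_of_le (hx j).1, ← restrict_linkMeasure_Ioc (hx j),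
        ← integral_mul_const]
      refine (integral_mono_of_nonneg (Eventually.of_forall fun t => by positivity)
        (hfi.mul_const ((a⁻¹) ^ 2)).restrict (Eventually.of_forall fun t => ?_)).trans
        (setIntegral_le_integral (hfi.mul_const _) (Eventually.of_forall fun t => by positivity))
      simp only
      rw [mul_comm]
      refine mul_le_mul_of_nonneg_left ?_ (sq_nonneg _)
      rw [← sq_abs]
      exact pow_le_pow_left₀ (abs_nonneg _) (abs_cutoffDeriv_le ha t) 2
    have hqn : (1 - ‖T‖) * ‖q‖ ^ 2 ≤ S * (a⁻¹) ^ 2 :=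
      (one_sub_norm_mul_sq_le T q).trans (hsum.le.trans hbound)
    intro j y hy hya
    have hky := hκ q j y hy
    rw [hq3 j y hy, cutoff_of_le hya, Complex.ofReal_one, one_mul] at hky
    have hky2 : ‖f j y‖ ^ 2 ≤ κ ^ 2 * ‖q‖ ^ 2 := by
      rw [← mul_pow]
      exact pow_le_pow_left₀ (norm_nonneg _) hky 2
    have h1T : 0 ≤ 1 - ‖T‖ := by linarith
    calc (1 - ‖T‖) * ‖f j y‖ ^ 2 ≤ (1 - ‖T‖) * (κ ^ 2 * ‖q‖ ^ 2) :=
          mul_le_mul_of_nonneg_left hky2 h1T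
      _ = κ ^ 2 * ((1 - ‖T‖) * ‖q‖ ^ 2) := by ring
      _ ≤ κ ^ 2 * (S * (a⁻¹) ^ 2) := mul_le_mul_of_nonneg_left hqn (sq_nonneg κ)
      _ = κ ^ 2 * S * (a⁻¹) ^ 2 := by ring
  -- Let `a → ∞` with the point `x` fixed.
  have hzero : ∀ j, ∀ x ∈ closedLink (ℓ j), f j x = 0 := by
    intro j x hx
    have hlim : Tendsto (fun a : ℝ => κ ^ 2 * S * (a⁻¹) ^ 2) atTop (𝓝 0) := by
      have := (tendsto_inv_atTop_zero (𝕜 := ℝ)).pow 2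
      simpa using this.const_mul (κ ^ 2 * S)
    have hev : ∀ᶠ a : ℝ in atTop, (1 - ‖T‖) * ‖f j x‖ ^ 2 ≤ κ ^ 2 * S * (a⁻¹) ^ 2 := by
      filter_upwards [eventually_gt_atTop 0, eventually_ge_atTop x,
        eventually_all.2 fun j => eventually_ge_atTop (ℓ j).toReal] with a ha hxa hla
      exact main a ha hla j x hx hxa
    have hle := ge_of_tendsto hlim hev
    have h1T : 0 < 1 - ‖T‖ := by linarith
    have h0 : ‖f j x‖ ^ 2 ≤ 0 := by
      by_contra hcon
      exact absurd hle (not_le.2 (mul_pos h1T (not_le.1 hcon)))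
    exact norm_eq_zero.1 (pow_eq_zero_iff two_ne_zero |>.1 (le_antisymm h0 (sq_nonneg _)))
  ext j : 1
  refine Lp.ext ?_
  filter_upwards [h1 j, Lp.coeFn_zero ℂ 2 (linkMeasure (ℓ j)),
    ae_restrict_mem (measurableSet_link (ℓ j))] with t a1 a2 a3
  rw [a1, hzero j t (link_subset_closedLink a3)]
  exact a2.symm

/-- The resolvent of the Hamiltonian in terms of the energy form. -/
theorem isResolventAt_formResolvent (hℓ : ∀ j, 0 < ℓ j)
    (hV : ∀ j, LocallyIntegrableOn (V j) (closedLink (ℓ j)) volume)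
    (hm : ∀ j, ∀ᵐ x ∂linkMeasure (ℓ j), m ≤ V j x)
    (hκ : TraceBound ℓ ω (formWeight V m) s κ) (hs : s ≠ 0) {α : ℝ} {U : Fin N → ℝ → ℝ}
    (hU : ∀ j, Integrable (U j) (linkMeasure (ℓ j)))
    {T : formDomain ℓ ω (formWeight V m) s →L[ℂ] formDomain ℓ ω (formWeight V m) s}
    (hT1 : ‖T‖ < 1) (hT : ∀ p q, ⟪T p, q⟫_ℂ =
      pertForm α U (fun j => endCoeff (ℓ j) (ω j)) (p : FormSpace ℓ) q) :
    IsResolventAt (hamiltonian ℓ ω α (fun j => V j + U j)) ((m - s ^ 2 : ℝ) : ℂ)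
      (formResolvent (formInclusion ℓ ω (formWeight V m) s) T) := by
  set H := hamiltonian ℓ ω α (fun j => V j + U j) with hH
  have hgraph : H.graph = hamiltonianGraph ℓ ω α (fun j => V j + U j) := graph_hamiltonian _ _ _ _
  have hsurj : ∀ y, ∃ x : H.domain, (x : StateSpace ℓ) =
      formResolvent (formInclusion ℓ ω (formWeight V m) s) T y ∧
      H x - ((m - s ^ 2 : ℝ) : ℂ) • (x : StateSpace ℓ) = y := by
    intro y
    obtain ⟨p, hp1, hp2⟩ := exists_weak_solution (formInclusion ℓ ω (formWeight V m) s) hT1 y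
    simp only [hT] at hp2
    have hmem := mem_hamiltonianGraph_of_inner hℓ hV hm hκ hs hU hp2
    rw [← hgraph, LinearPMap.mem_graph_iff] at hmem
    obtain ⟨x, hx1, hx2⟩ := hmem
    refine ⟨x, hx1.trans hp1, ?_⟩
    rw [hx2, hx1]
    simp
  refine ⟨hsurj, fun x => ?_⟩
  -- `x` and `x'` have the same image under `H - (m - s²)`, so injectivity upgrades the right
  -- inverse to a two-sided one.
  obtain ⟨x', hx1, hx2⟩ := hsurj (H x - ((m - s ^ 2 : ℝ) : ℂ) • (x : StateSpace ℓ))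
  rw [← hx1, ← sub_eq_zero]
  refine eq_zero_of_mem_hamiltonianGraph hℓ hV hm hκ hU hT1 hT ?_
  rw [← hgraph, LinearPMap.mem_graph_iff]
  refine ⟨x' - x, by simp, ?_⟩
  rw [LinearPMap.map_sub]
  simp only [smul_sub]
  exact sub_eq_sub_iff_sub_eq_sub.1 hx2

end Injectivity

/-! ### Scaling of the squeezed potentials -/

section Squeezed

variable {ℓ : EReal} {ε : ℝ} {W : ℝ → ℝ}

theorem integrable_squeezed (hε : 0 < ε) (hW : Integrable W (linkMeasure ℓ)) :
    Integrable (squeezed ℓ ε W) (linkMeasure ℓ) := by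
  have h1 : Integrable ((link ℓ).indicator W) volume :=
    (integrable_indicator_iff (measurableSet_link ℓ)).2 hW
  exact ((h1.comp_div hε.ne').const_mul ε⁻¹).restrict

/-- For `ε ≤ 1` one has `x ≤ x / ε`, so the squeezed potential is supported inside the link and no
mass is lost by restricting to it. -/
theorem mem_link_of_div_mem {x : ℝ} (hε : 0 < ε) (hε1 : ε ≤ 1) (hx : x / ε ∈ link ℓ) :
    x ∈ link ℓ := by
  have h0 : 0 < x := by
    have := mul_pos hx.1 hε
    rwa [div_mul_cancel₀ x hε.ne'] at this
  refine ⟨h0, lt_of_le_of_lt ?_ hx.2⟩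
  exact EReal.coe_le_coe_iff.2 (le_div_self h0.le hε hε1)

/-- Change of variables for integrals against a squeezed potential. -/
theorem integral_squeezed_smul {E : Type*} [NormedAddCommGroup E] [NormedSpace ℝ E] (hε : 0 < ε)
    (hε1 : ε ≤ 1) (W : ℝ → ℝ) (h : ℝ → E) :
    ∫ x, squeezed ℓ ε W x • h x ∂linkMeasure ℓ = ∫ y, W y • h (ε * y) ∂linkMeasure ℓ := by
  have h1 : ∫ x, squeezed ℓ ε W x • h x ∂linkMeasure ℓ = ∫ x, squeezed ℓ ε W x • h x := by
    refine setIntegral_eq_integral_of_forall_compl_eq_zero fun x hx => ?_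
    have hn : x / ε ∉ link ℓ := fun hmem => hx (mem_link_of_div_mem hε hε1 hmem)
    rw [squeezed, indicator_of_notMem hn, mul_zero, zero_smul]
  have h2 : ∀ x, squeezed ℓ ε W x • h x =
      (fun y => ε⁻¹ • (link ℓ).indicator (fun y => W y • h (ε * y)) y) (x / ε) := by
    intro x
    simp only [squeezed]
    by_cases hx : x / ε ∈ link ℓ
    · rw [indicator_of_mem hx, indicator_of_mem hx, mul_div_cancel₀ x hε.ne', smul_smul]
    · rw [indicator_of_notMem hx, indicator_of_notMem hx, mul_zero, zero_smul, smul_zero]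
  rw [h1]
  simp only [h2]
  rw [Measure.integral_comp_div (fun y => ε⁻¹ • (link ℓ).indicator (fun y => W y • h (ε * y)) y) ε,
    integral_smul, integral_indicator (measurableSet_link ℓ), abs_of_pos hε, smul_smul,
    mul_inv_cancel₀ hε.ne', one_smul]

/-- Invariance of the `L¹` norm under squeezing makes the contraction bound uniform in `ε`. -/
theorem integral_abs_squeezed (hε : 0 < ε) (hε1 : ε ≤ 1) (W : ℝ → ℝ) :
    ∫ x, |squeezed ℓ ε W x| ∂linkMeasure ℓ = ∫ y, |W y| ∂linkMeasure ℓ := by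
  have h := integral_squeezed_smul (ℓ := ℓ) hε hε1 (fun y => |W y|) (fun _ => (1 : ℝ))
  simp only [smul_eq_mul, mul_one] at h
  rw [← h]
  congr 1
  funext x
  simp only [squeezed]
  rw [abs_mul, abs_of_pos (inv_pos.2 hε)]
  by_cases hx : x / ε ∈ link ℓ
  · rw [indicator_of_mem hx, indicator_of_mem hx]
  · rw [indicator_of_notMem hx, indicator_of_notMem hx, abs_zero]

end Squeezed

/-! ### Convergence of the perturbing forms -/

section Convergence

open scoped InnerProductSpace

variable {N : ℕ} {ℓ : Fin N → EReal} {ω : Fin N → ℝ} {w : Fin N → ℝ → ℝ} {s κ : ℝ}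

/-- Modulus of continuity at the vertex of products of functions in the form domain. -/
def vertexModulus (κ u : ℝ) : ℝ := min (2 * κ * Real.sqrt u) (2 * κ ^ 2)

theorem continuous_vertexModulus (κ : ℝ) : Continuous (vertexModulus κ) := by
  unfold vertexModulus
  fun_prop

theorem vertexModulus_zero (κ : ℝ) : vertexModulus κ 0 = 0 := by
  simp [vertexModulus, sq_nonneg]

theorem abs_vertexModulus_le (hκ0 : 0 ≤ κ) (u : ℝ) : |vertexModulus κ u| ≤ 2 * κ ^ 2 := by
  rw [abs_of_nonneg (le_min (by positivity) (by positivity))]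
  exact min_le_right _ _

/-- The square-root bound comes from Hölder continuity and is small near the vertex; the constant
bound comes from the trace inequality. The minimum of the two is bounded, so integrability of `W`
suffices and no moment is needed. -/
theorem norm_conj_mul_evalAt_sub_le (hκ0 : 0 ≤ κ) (hκ : TraceBound ℓ ω w s κ) {j : Fin N}
    (hℓ : 0 < ℓ j) {u : ℝ} (hu : u ∈ closedLink (ℓ j)) (p q : formDomain ℓ ω w s) :
    ‖starRingEnd ℂ (evalAt j u (p : FormSpace ℓ)) * evalAt j u (q : FormSpace ℓ) -
      starRingEnd ℂ (vertex (p : FormSpace ℓ)) * vertex (q : FormSpace ℓ)‖ ≤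
      vertexModulus κ u * (‖p‖ * ‖q‖) := by
  have h0 := zero_mem_closedLink hℓ
  have hd : ∀ r : formDomain ℓ ω w s, ‖evalAt j u (r : FormSpace ℓ) - vertex (r : FormSpace ℓ)‖ ≤
      Real.sqrt u * ‖r‖ := by
    intro r
    have h1 := norm_evalAt_sub_le j le_rfl hu.1 (r : FormSpace ℓ)
    rw [evalAt_zero, sub_zero] at h1
    refine h1.trans (mul_le_mul_of_nonneg_left ?_ (Real.sqrt_nonneg _))
    have h2 := sq_norm_component_add_le (r : FormSpace ℓ) j
    refine le_of_sq_le_sq ?_ (norm_nonneg _)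
    exact (le_add_of_nonneg_right (sq_nonneg _)).trans h2
  rw [vertexModulus, min_mul_of_nonneg _ _ (by positivity)]
  refine le_min ?_ ?_
  · have e : starRingEnd ℂ (evalAt j u (p : FormSpace ℓ)) * evalAt j u (q : FormSpace ℓ) -
        starRingEnd ℂ (vertex (p : FormSpace ℓ)) * vertex (q : FormSpace ℓ) =
        starRingEnd ℂ (evalAt j u (p : FormSpace ℓ) - vertex (p : FormSpace ℓ)) *
          evalAt j u (q : FormSpace ℓ) + starRingEnd ℂ (vertex (p : FormSpace ℓ)) *
          (evalAt j u (q : FormSpace ℓ) - vertex (q : FormSpace ℓ)) := by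
      rw [map_sub]
      ring
    rw [e]
    refine (norm_add_le _ _).trans ?_
    rw [norm_mul, norm_mul, RCLike.norm_conj, RCLike.norm_conj]
    have hp0 := hκ p j 0 h0
    rw [evalAt_zero] at hp0
    have t1 := mul_le_mul (hd p) (hκ q j u hu) (norm_nonneg _)
      (mul_nonneg (Real.sqrt_nonneg _) (norm_nonneg _))
    have t2 := mul_le_mul hp0 (hd q) (norm_nonneg _) (mul_nonneg hκ0 (norm_nonneg _))
    linarith
  · have t1 := norm_conj_mul_evalAt_le hκ hu p q
    have t2 := norm_conj_mul_evalAt_le hκ h0 p q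
    rw [evalAt_zero, evalAt_zero] at t2
    refine (norm_sub_le _ _).trans ?_
    linarith

/-- The distance between the energy form of the squeezed potentials and that of the coupling. -/
theorem norm_pertForm_sub_le (hℓ : ∀ j, 0 < ℓ j) (hκ0 : 0 ≤ κ) (hκ : TraceBound ℓ ω w s κ)
    {W : Fin N → ℝ → ℝ} (hW : ∀ j, Integrable (W j) (linkMeasure (ℓ j))) (θ : Fin N → ℝ) {ε : ℝ}
    (hε : 0 < ε) (hε1 : ε ≤ 1) (p q : formDomain ℓ ω w s) :
    ‖pertForm 0 (fun j => squeezed (ℓ j) ε (W j)) θ (p : FormSpace ℓ) q -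
      pertForm (∑ j, ∫ x, W j x ∂linkMeasure (ℓ j)) (fun _ => 0) θ (p : FormSpace ℓ) q‖ ≤
      (∑ j, ∫ y, |W j y| * vertexModulus κ (ε * y) ∂linkMeasure (ℓ j)) * ‖p‖ * ‖q‖ := by
  have hscale : ∀ j, ∀ y ∈ link (ℓ j), ε * y ∈ closedLink (ℓ j) := fun j y hy => by
    refine link_subset_closedLink (mem_link_of_div_mem hε hε1 ?_)
    rwa [mul_div_cancel_left₀ y hε.ne']
  set A : Fin N → ℝ → ℂ := fun j x => starRingEnd ℂ (evalAt j x (p : FormSpace ℓ)) *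
    evalAt j x (q : FormSpace ℓ) with hA
  set c : ℂ := starRingEnd ℂ (vertex (p : FormSpace ℓ)) * vertex (q : FormSpace ℓ) with hc
  have hsq : ∀ j, ∫ x, (squeezed (ℓ j) ε (W j) x : ℂ) * A j x ∂linkMeasure (ℓ j) =
      ∫ y, (W j y : ℂ) * A j (ε * y) ∂linkMeasure (ℓ j) := fun j => by
    simpa only [Complex.real_smul] using integral_squeezed_smul (ℓ := ℓ j) hε hε1 (W j) (A j)
  have hmod : ∀ j, Integrable (fun y => |W j y| * vertexModulus κ (ε * y)) (linkMeasure (ℓ j)) :=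
    fun j => (hW j).abs.mul_bdd (c := 2 * κ ^ 2)
      (((continuous_vertexModulus κ).comp (continuous_const.mul continuous_id)).aestronglyMeasurable)
      (Eventually.of_forall fun y => abs_vertexModulus_le hκ0 _)
  have hbd : ∀ j, ∀ᵐ y ∂linkMeasure (ℓ j), ‖(W j y : ℂ) * (A j (ε * y) - c)‖ ≤
      |W j y| * vertexModulus κ (ε * y) * (‖p‖ * ‖q‖) := by
    intro j
    filter_upwards [ae_restrict_mem (measurableSet_link (ℓ j))] with y hy
    rw [norm_mul, Complex.norm_real, Real.norm_eq_abs, mul_assoc]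
    exact mul_le_mul_of_nonneg_left
      (norm_conj_mul_evalAt_sub_le hκ0 hκ (hℓ j) (hscale j y hy) p q) (abs_nonneg _)
  have hAi : ∀ j, Integrable (fun y => (W j y : ℂ) * A j (ε * y)) (linkMeasure (ℓ j)) := by
    intro j
    have hm : AEStronglyMeasurable (fun y => A j (ε * y)) (linkMeasure (ℓ j)) := by
      have hcont : ∀ r : FormSpace ℓ, ContinuousOn (fun y => evalAt j (ε * y) r) (link (ℓ j)) := by
        intro r y hy
        obtain ⟨b, hb1, hb2⟩ := EReal.lt_iff_exists_rat_btwn.1 hy.2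
        have hb1' : y < (b : ℝ) := by exact_mod_cast hb1
        have hb : (b : ℝ) ∈ closedLink (ℓ j) := ⟨(hy.1.trans hb1').le, hb2.le⟩
        have hlt : ε * y < b := (mul_le_of_le_one_left hy.1.le hε1).trans_lt hb1'
        have h1 := ((hasLocACDeriv_evalAt j r).continuousOn_Icc hb).continuousAt
          (Icc_mem_nhds (mul_pos hε hy.1) hlt)
        exact (ContinuousAt.comp (f := fun y => ε * y) (g := fun x => evalAt j x r) h1
          (by fun_prop)).continuousWithinAt
      exact ((Complex.continuous_conj.comp_continuousOn (hcont p)).mul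
        (hcont q)).aestronglyMeasurable (measurableSet_link (ℓ j))
    refine (hW j).ofReal.mul_bdd (c := κ ^ 2 * ‖p‖ * ‖q‖) hm ?_
    filter_upwards [ae_restrict_mem (measurableSet_link (ℓ j))] with y hy
    exact norm_conj_mul_evalAt_le hκ (hscale j y hy) p q
  -- The end terms and the compensating vertex terms cancel; the coupling `α c` is spread out as `∑ⱼ
  -- ∫ Wⱼ c`.
  have e : pertForm 0 (fun j => squeezed (ℓ j) ε (W j)) θ (p : FormSpace ℓ) q -
      pertForm (∑ j, ∫ x, W j x ∂linkMeasure (ℓ j)) (fun _ => 0) θ (p : FormSpace ℓ) q =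
      ∑ j, ∫ y, (W j y : ℂ) * (A j (ε * y) - c) ∂linkMeasure (ℓ j) := by
    have hj : ∀ j, ∫ y, (W j y : ℂ) * (A j (ε * y) - c) ∂linkMeasure (ℓ j) =
        ∫ y, (W j y : ℂ) * A j (ε * y) ∂linkMeasure (ℓ j) -
          ((∫ y, W j y ∂linkMeasure (ℓ j) : ℝ) : ℂ) * c := by
      intro j
      have hWc : Integrable (fun y => (W j y : ℂ)) (linkMeasure (ℓ j)) := (hW j).ofReal
      simp only [mul_sub]
      rw [integral_sub (hAi j) (hWc.mul_const c), integral_mul_const,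
        integral_complex_ofReal]
    simp only [hj, pertForm]
    simp only [hA] at hsq
    simp only [hsq, hA, Finset.sum_add_distrib, Finset.sum_sub_distrib, ← Finset.sum_mul,
      Pi.zero_apply, Complex.ofReal_zero, zero_mul, integral_zero, Finset.sum_const_zero]
    push_cast
    ring
  rw [e, mul_assoc, Finset.sum_mul]
  refine (norm_sum_le _ _).trans (Finset.sum_le_sum fun j _ => ?_)
  rw [← integral_mul_const]
  exact norm_integral_le_of_norm_le ((hmod j).mul_const _) (hbd j)

/-- Dominated convergence with majorant `2κ²|W|`, the modulus being continuous and zero at `0`. -/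
theorem tendsto_integral_vertexModulus (hκ0 : 0 ≤ κ) {W : Fin N → ℝ → ℝ}
    (hW : ∀ j, Integrable (W j) (linkMeasure (ℓ j))) :
    Tendsto (fun ε : ℝ => ∑ j, ∫ y, |W j y| * vertexModulus κ (ε * y) ∂linkMeasure (ℓ j))
      (𝓝[>] 0) (𝓝 0) := by
  have hj : ∀ j ∈ Finset.univ, Tendsto (fun ε : ℝ => ∫ y, |W j y| * vertexModulus κ (ε * y)
      ∂linkMeasure (ℓ j)) (𝓝[>] 0) (𝓝 (∫ _, (0 : ℝ) ∂linkMeasure (ℓ j))) := by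
    intro j _
    refine tendsto_integral_filter_of_dominated_convergence (fun y => |W j y| * (2 * κ ^ 2))
      (Eventually.of_forall fun ε => (hW j).abs.aestronglyMeasurable.mul
        ((continuous_vertexModulus κ).comp
          (continuous_const.mul continuous_id)).aestronglyMeasurable)
      (Eventually.of_forall fun ε => Eventually.of_forall fun y => ?_)
      ((hW j).abs.mul_const _) (Eventually.of_forall fun y => ?_)
    · rw [norm_mul, Real.norm_eq_abs, Real.norm_eq_abs, abs_abs]
      exact mul_le_mul_of_nonneg_left (abs_vertexModulus_le hκ0 _) (abs_nonneg _)
    · have hc : Continuous fun ε : ℝ => |W j y| * vertexModulus κ (ε * y) :=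
        continuous_const.mul ((continuous_vertexModulus κ).comp (continuous_id.mul continuous_const))
      have := (hc.tendsto 0).mono_left (nhdsWithin_le_nhds (s := Ioi 0))
      simpa [vertexModulus_zero] using this
  simpa using tendsto_finsetSum Finset.univ hj

end Convergence

end

end StarGraph

/-! ### The main theorem -/

open StarGraph in
theorem mainTheorem2 {N : ℕ} (hN : 2 ≤ N)
    (ℓ : Fin N → EReal) (hℓ : ∀ j, 0 < ℓ j) (ω : Fin N → ℝ)
    (V W : Fin N → ℝ → ℝ)
    (hV : ∀ j, LocallyIntegrableOn (V j) (StarGraph.closedLink (ℓ j)) volume)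
    (hVbdd : ∀ j, ∃ m : ℝ, ∀ᵐ x ∂StarGraph.linkMeasure (ℓ j), m ≤ V j x)
    (hW : ∀ j, Integrable (W j) (StarGraph.linkMeasure (ℓ j))) :
    StarGraph.NormResolventTendsto
      (fun ε : ℝ => StarGraph.hamiltonian ℓ ω 0
        (fun j => V j + StarGraph.squeezed (ℓ j) ε (W j)))
      (𝓝[>] 0)
      (StarGraph.hamiltonian ℓ ω (∑ j, ∫ x, W j x ∂StarGraph.linkMeasure (ℓ j)) V) := by
  have hN0 : 0 < N := by omega
  obtain ⟨m, hm⟩ : ∃ m : ℝ, ∀ j, ∀ᵐ x ∂linkMeasure (ℓ j), m ≤ V j x := by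
    choose m hm using hVbdd
    refine ⟨-∑ j, |m j|, fun j => ?_⟩
    filter_upwards [hm j] with x hx
    have h1 := Finset.single_le_sum (f := fun j => |m j|) (fun _ _ => abs_nonneg _)
      (Finset.mem_univ j)
    linarith [neg_abs_le (m j)]
  set θ : Fin N → ℝ := fun j => endCoeff (ℓ j) (ω j) with hθ
  set α : ℝ := ∑ j, ∫ x, W j x ∂linkMeasure (ℓ j) with hα
  -- One constant for both forms: the squeezed one has `|0 - 1| = 1`, and the limit has no potential
  -- but `|α - 1| ≤ 1 + ∑ⱼ ∫ |Wⱼ|`.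
  set C : ℝ := 1 + ∑ j, (∫ x, |W j x| ∂linkMeasure (ℓ j) + |θ j|) with hC
  -- `κ² = 2L` must satisfy `C κ² < 1`, and a window of length `L` must fit into every link.
  obtain ⟨L, hL0, hLC, hLℓ⟩ : ∃ L : ℝ, 0 < L ∧ C * (2 * L) < 1 ∧ ∀ j, (L : EReal) ≤ ℓ j := by
    choose y hy using fun j => exists_pos_mem_link (hℓ j)
    have h1 : ∀ᶠ L in 𝓝[>] (0 : ℝ), C * (2 * L) < 1 := by
      have hc : Continuous fun L : ℝ => C * (2 * L) := by fun_prop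
      have ht := (hc.tendsto 0).mono_left (nhdsWithin_le_nhds (s := Ioi 0))
      exact ht.eventually (gt_mem_nhds (by simp))
    have h2 : ∀ᶠ L in 𝓝[>] (0 : ℝ), ∀ j, L < y j := eventually_all.2 fun j =>
      eventually_nhdsWithin_of_eventually_nhds (gt_mem_nhds (hy j).1)
    have h0 : ∀ᶠ L in 𝓝[>] (0 : ℝ), 0 < L := self_mem_nhdsWithin
    obtain ⟨L, hL0, h1, h2⟩ := (h0.and (h1.and h2)).exists
    exact ⟨L, hL0, h1, fun j => ((EReal.coe_lt_coe_iff.2 (h2 j)).trans (hy j).2).le⟩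
  set s : ℝ := L⁻¹ with hs
  set κ : ℝ := Real.sqrt (2 * L) with hκdef
  have hs0 : s ≠ 0 := inv_ne_zero hL0.ne'
  have hκ0 : 0 ≤ κ := Real.sqrt_nonneg _
  have hκ2 : κ ^ 2 = 2 * L := Real.sq_sqrt (by positivity)
  have hκ : TraceBound ℓ ω (formWeight V m) s κ := by
    intro p j x hx
    have h1 := sq_norm_evalAt_le hL0 (inv_mul_cancel₀ hL0.ne') (hLℓ j) p hx
    refine le_of_sq_le_sq ?_ (mul_nonneg hκ0 (norm_nonneg _))
    rwa [mul_pow, hκ2]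
  have hαle : |α| ≤ ∑ j, ∫ x, |W j x| ∂linkMeasure (ℓ j) :=
    (Finset.abs_sum_le_sum_abs _ _).trans
      (Finset.sum_le_sum fun j _ => abs_integral_le_integral_abs)
  obtain ⟨S, hSsa, hSn, hS⟩ := exists_pertOperator hN0 hℓ hκ α (U := fun _ => 0)
    (fun j => integrable_zero _ _ _) θ
  have hS1 : ‖S‖ < 1 := by
    refine hSn.trans_lt (lt_of_le_of_lt ?_ hLC)
    rw [hκ2]
    refine mul_le_mul_of_nonneg_right ?_ (by positivity)
    simp only [Pi.zero_apply, abs_zero, integral_zero, zero_add]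
    rw [hC, Finset.sum_add_distrib]
    have := abs_sub α 1
    rw [abs_one] at this
    linarith
  have hex : ∀ ε : ℝ, ∃ T : formDomain ℓ ω (formWeight V m) s →L[ℂ]
      formDomain ℓ ω (formWeight V m) s, 0 < ε → ε ≤ 1 → IsSelfAdjoint T ∧ ‖T‖ < 1 ∧
      ∀ p q, inner ℂ (T p) q = pertForm 0 (fun j => squeezed (ℓ j) ε (W j)) θ (p : FormSpace ℓ) q := by
    intro ε
    by_cases hε : 0 < ε ∧ ε ≤ 1
    · obtain ⟨T, h1, h2, h3⟩ := exists_pertOperator hN0 hℓ hκ 0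
        (fun j => integrable_squeezed hε.1 (hW j)) θ
      refine ⟨T, fun _ _ => ⟨h1, h2.trans_lt (lt_of_le_of_lt (le_of_eq ?_) hLC), h3⟩⟩
      simp only [integral_abs_squeezed hε.1 hε.2]
      rw [hκ2, hC]
      norm_num
    -- Outside `0 < ε ≤ 1` the value is irrelevant; it only makes `T` a function on all of `ℝ`.
    · exact ⟨0, fun h1 h2 => absurd ⟨h1, h2⟩ hε⟩
  choose T hT using hex
  have hsmall : ∀ᶠ ε : ℝ in 𝓝[>] 0, 0 < ε ∧ ε ≤ 1 := by
    filter_upwards [self_mem_nhdsWithin,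
      eventually_nhdsWithin_of_eventually_nhds (ge_mem_nhds zero_lt_one)] with ε h1 h2
    exact ⟨h1, h2⟩
  have hTS : Tendsto T (𝓝[>] 0) (𝓝 S) := by
    refine tendsto_of_norm_inner_sub_le (tendsto_integral_vertexModulus (ℓ := ℓ) hκ0 hW) ?_
    filter_upwards [hsmall] with ε hε
    refine ⟨Finset.sum_nonneg fun j _ => integral_nonneg fun y =>
      mul_nonneg (abs_nonneg _) (le_min (by positivity) (by positivity)), fun p q => ?_⟩
    rw [(hT ε hε.1 hε.2).2.2, hS]
    exact norm_pertForm_sub_le hℓ hκ0 hκ hW θ hε.1 hε.2 p q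
  have hSres := isResolventAt_formResolvent hℓ hV hm hκ hs0 (α := α) (U := fun _ => 0)
    (fun j => integrable_zero _ _ _) hS1 hS
  simp only [add_zero] at hSres
  refine normResolventTendsto_of_tendsto (t := m - s ^ 2) ?_ ?_
    (isSelfAdjoint_formResolvent (formInclusion ℓ ω (formWeight V m) s) hSsa) hSres
    (tendsto_formResolvent _ hS1 hTS)
  · filter_upwards [hsmall] with ε hε
    exact isSelfAdjoint_formResolvent _ (hT ε hε.1 hε.2).1
  · filter_upwards [hsmall] with ε hε
    exact isResolventAt_formResolvent hℓ hV hm hκ hs0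
      (fun j => integrable_squeezed hε.1 (hW j)) (hT ε hε.1 hε.2).2.1 (hT ε hε.1 hε.2).2.2
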